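/- Let $\mathcal N$ be a finite set of operators. The transmitters of the operators $j\in\mathcal N$ form independent homogeneous Poisson point processes $\Phi_j\subset\mathbb R^2$ of intensities $\lambda_j>0$; put $\Phi=\bigcup_j\Phi_j$. Every operator owns one spectrum band, and all transmitters use all $|\mathcal N|$ bands. Let $h^k_y$ be the power fading between the transmitter $y\in\Phi$ and a user at the origin in band $k\in\mathcal N$; all the variables $h^k_y$ are exponential with mean $1$, independent of each other (across transmitters and across bands: frequency-selective Rayleigh fading), and independent of the transmitter locations. The path loss is $l(y)=\|y\|^{-\alpha}$ with $\alpha>2$. Let $n\in\mathcal N$, let $x$ be the point of $\Phi_n$ closest to the origin, let $W\ge 0$ be the noise level and $\eta\ge 0$ the scalar that accounts for power splitting ($\eta=1$ for one band in use, $\eta=|\mathcal N|$ for all bands in use), and let $$\mathrm{SINR}_k=\frac{h^k_x\,l(x)}{\eta W+\sum_{y\in\Phi\setminus\{x\}}h^k_y\,l(y)}\qquad(k\in\mathcal N).$$ For $\theta>0$ the coverage probability of a user of operator $n$ is the probability that at least one band exceeds the threshold, $p_n(\theta)=\mathbb P\big(\bigcup_{k\in\mathcal N}\{\mathrm{SINR}_k>\theta\}\big)$.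 Then $$p_n(\theta)=\pi\lambda_n\sum_{k=1}^{|\mathcal N|}\binom{|\mathcal N|}{k}(-1)^{k+1}\int_0^\infty \exp\!\big(-\theta r^{\alpha/2}k\,\eta W\big)\exp\!\bigg(-\pi r\Big(\lambda_n+\lambda_n\sum_{l=1}^k\binom kl(-1)^{l+1}\mathfrak Z(\theta,\alpha,l)+\sum_{j\in\mathcal N\setminus\{n\}}\lambda_j\sum_{l=1}^k\binom kl(-1)^{l+1}\mathfrak Z_0(\theta,\alpha,l)\Big)\bigg)\,dr,$$ where all these integrals converge absolutely and $$\mathfrak Z(\theta,\alpha,l)=\frac{2\theta^l}{l\alpha-2}\,{}_2F_1\big(l,\,l-2/\alpha;\,l-2/\alpha+1;\,-\theta\big),\qquad \mathfrak Z_0(\theta,\alpha,l)=\frac{2\theta^{2/\alpha}}{\alpha}\,B\big(2/\alpha,\,l-2/\alpha\big).$$ Here ${}_2F_1$ is the Gauss hypergeometric function (continued analytically from $(-1,1)$ to $(-\infty,1)$) and $B$ is the Beta function. -/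

import Mathlib

open MeasureTheory ProbabilityTheory
open scoped ENNReal

namespace SpectrumSharing

noncomputable section

/-! ### Special functions -/

/-- `F` is a real-analytic function on `(-∞, 1)` that is given by the Gauss hypergeometric series
on `(-1, 1)`. -/
def IsHypergeometricContinuation (a b c : ℝ) (F : ℝ → ℝ) : Prop :=
  AnalyticOnNhd ℝ F (Set.Iio 1) ∧ ∀ x ∈ Set.Ioo (-1 : ℝ) 1, F x = ordinaryHypergeometric a b c x

open Classical in
/-- The Gauss hypergeometric function `₂F₁(a, b; c; z)` for real `z < 1`: the analytic continuation
of the hypergeometric series from `(-1, 1)` to `(-∞, 1)`. (Mathlib's `ordinaryHypergeometric` is the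
sum of the series, which diverges for `z < -1`.) -/
def gaussHypergeometric (a b c z : ℝ) : ℝ :=
  if h : ∃ F : ℝ → ℝ, IsHypergeometricContinuation a b c F then h.choose z else 0

/-- The continuation is unique, so every continuation computes `gaussHypergeometric`. -/
theorem gaussHypergeometric_eq {a b c : ℝ} {F : ℝ → ℝ} (hF : IsHypergeometricContinuation a b c F)
    {z : ℝ} (hz : z < 1) : gaussHypergeometric a b c z = F z := by
  have h : ∃ F : ℝ → ℝ, IsHypergeometricContinuation a b c F := ⟨F, hF⟩
  have hs := h.choose_spec
  rw [gaussHypergeometric, dif_pos h]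
  refine hs.1.eqOn_of_preconnected_of_eventuallyEq hF.1 isPreconnected_Iio
    (z₀ := 0) (by simp) ?_ hz
  filter_upwards [Ioo_mem_nhds (show (-1 : ℝ) < 0 by norm_num) (show (0 : ℝ) < 1 by norm_num)]
    with x hx
  rw [hs.2 x hx, hF.2 x hx]

/-- `𝔷(θ, α, l) = (2 θ^l / (l α - 2)) ₂F₁(l, l - 2/α; l - 2/α + 1; -θ)`. -/
def zeta (θ α : ℝ) (l : ℕ) : ℝ :=
  2 * θ ^ l / (l * α - 2) * gaussHypergeometric l (l - 2 / α) (l - 2 / α + 1) (-θ)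

/-- `𝔷₀(θ, α, l) = (2 θ^(2/α) / α) B(2/α, l - 2/α)`, with `B` the Beta function. -/
def zetaZero (θ α : ℝ) (l : ℕ) : ℝ :=
  2 * θ ^ (2 / α) / α * ProbabilityTheory.beta (2 / α) (l - 2 / α)

/-! ### Homogeneous Poisson point processes in the plane -/

/-- The Euclidean plane. -/
abbrev Plane : Type := EuclideanSpace ℝ (Fin 2)

/-- The number of points of the set `S` in `B`. -/
def count (S B : Set Plane) : ℕ∞ := (S ∩ B).encard

/-- The random set `Φ` is a homogeneous Poisson point process of intensity `lam` in the plane: the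
number of its points in a Borel set `B` of finite area is a Poisson random variable with mean
`lam * area B`, and the numbers of its points in pairwise disjoint Borel sets are independent. -/
structure IsPoissonProcess {Ω : Type*} [MeasurableSpace Ω] (P : Measure Ω)
    (Φ : Ω → Set Plane) (lam : ℝ) : Prop where
  measurable_count : ∀ B : Set Plane, MeasurableSet B → Measurable fun ω => count (Φ ω) B
  law_count : ∀ B : Set Plane, MeasurableSet B → volume B ≠ ∞ →
    HasLaw (fun ω => count (Φ ω) B)
      ((poissonMeasure (lam.toNNReal * (volume B).toNNReal)).map (fun m : ℕ => (m : ℕ∞))) P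
  indep_count : ∀ (m : ℕ) (B : Fin m → Set Plane), (∀ i, MeasurableSet (B i)) →
    Pairwise (Function.onFun Disjoint B) → iIndepFun (fun i ω => count (Φ ω) (B i)) P

/-! ### The network model -/

section Model

variable {Ω N : Type*}

/-- The set of transmitters of operator `j`; `X j i` is the location of its `i`-th transmitter. -/
def network (X : N → ℕ → Ω → Plane) (j : N) (ω : Ω) : Set Plane :=
  Set.range fun i => X j i ω

/-- The spectrum sharing model under frequency-selective Rayleigh fading. The transmitters of the
operators `j : N` form independent homogeneous Poisson point processes of intensities `lam j`. The
transmitters of operator `j` are listed without repetition as `X j 0, X j 1, …`, and `h j i k` is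
the power fading between transmitter `i` of operator `j` and the user at the origin in the spectrum
band of operator `k`. All these fading variables are independent, exponential with mean one, and
independent of the locations. -/
structure IsModel [MeasurableSpace Ω] (P : Measure Ω) (lam : N → ℝ) (X : N → ℕ → Ω → Plane)
    (h : N → ℕ → N → Ω → ℝ) : Prop where
  measurable_location : ∀ j i, Measurable (X j i)
  injective_location : ∀ j, ∀ᵐ ω ∂P, Function.Injective fun i => X j i ω
  poisson : ∀ j, IsPoissonProcess P (network X j) (lam j)
  indep_network :
    iIndepFun (fun j ω (B : {B : Set Plane // MeasurableSet B}) => count (network X j ω) B.1) P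
  measurable_fading : ∀ j i k, Measurable (h j i k)
  law_fading : ∀ j i k, HasLaw (h j i k) (expMeasure 1) P
  indep_fading : iIndepFun (fun (p : N × ℕ × N) ω => h p.1 p.2.1 p.2.2 ω) P
  indep_location_fading :
    IndepFun (fun ω (p : N × ℕ) => X p.1 p.2 ω) (fun ω (p : N × ℕ × N) => h p.1 p.2.1 p.2.2 ω) P

/-- The index of the transmitter that serves the user of operator `n` at the origin: the closest
transmitter of operator `n` (the one of smallest index in the null event of a tie). -/
def serving (X : N → ℕ → Ω → Plane) (n : N) (ω : Ω) : ℕ :=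
  sInf {i | ∀ i', ‖X n i ω‖ ≤ ‖X n i' ω‖}

/-- The power `h l(x)`, with path loss `l(x) = ‖x‖^(-α)`, that the user at the origin receives in
band `k` from transmitter `i` of operator `j`. -/
def power (α : ℝ) (X : N → ℕ → Ω → Plane) (h : N → ℕ → N → Ω → ℝ) (j : N) (i : ℕ) (k : N)
    (ω : Ω) : ℝ :=
  h j i k ω * ‖X j i ω‖ ^ (-α)

/-- The interference in band `k`: the total power received from all transmitters of all operators
other than the serving one. -/
def interference (α : ℝ) (X : N → ℕ → Ω → Plane) (h : N → ℕ → N → Ω → ℝ) (n k : N) (ω : Ω) :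
    ℝ≥0∞ :=
  ∑' y : {y : N × ℕ // y ≠ (n, serving X n ω)}, ENNReal.ofReal (power α X h y.1.1 y.1.2 k ω)

/-- The signal to interference and noise ratio of the user of operator `n` in band `k`, with noise
power `η W`. -/
def SINR (α W η : ℝ) (X : N → ℕ → Ω → Plane) (h : N → ℕ → N → Ω → ℝ) (n k : N) (ω : Ω) : ℝ≥0∞ :=
  ENNReal.ofReal (power α X h n (serving X n ω) k ω) /
    (ENNReal.ofReal (η * W) + interference α X h n k ω)

/-- The coverage probability of the user of operator `n`: the probability that the SINR exceeds the
threshold `θ` in at least one of the shared bands. -/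
def coverageProbability [MeasurableSpace Ω] (P : Measure Ω) (α W η θ : ℝ)
    (X : N → ℕ → Ω → Plane) (h : N → ℕ → N → Ω → ℝ) (n : N) : ℝ :=
  P.real {ω | ∃ k : N, ENNReal.ofReal θ < SINR α W η X h n k ω}

/-- The integrand of the `k`-th term of the coverage probability. -/
def coverageIntegrand [Fintype N] [DecidableEq N] (lam : N → ℝ) (α W η θ : ℝ) (n : N) (k : ℕ)
    (r : ℝ) : ℝ :=
  Real.exp (-(θ * r ^ (α / 2) * k * (η * W))) *
    Real.exp (-(Real.pi * r *
      (lam n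
        + lam n * ∑ l ∈ Finset.Icc 1 k, (k.choose l : ℝ) * (-1) ^ (l + 1) * zeta θ α l
        + ∑ j ∈ Finset.univ.erase n, lam j *
            ∑ l ∈ Finset.Icc 1 k, (k.choose l : ℝ) * (-1) ^ (l + 1) * zetaZero θ α l)))

end Model

end

end SpectrumSharing

open Filter Topology

namespace SpectrumSharing

noncomputable section

/-! ### The exponential of a nonpositive extended real -/

/-! Inclusion–exclusion over the bands reduces the claim to the probability that the SINR exceeds
`θ` in all bands of a set `S`, which depends only on `m = S.card`. Given the locations, with the
serving transmitter at distance `R`, exponential tails and independence of the fading evaluate this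
probability as `exp(-m θ R^α η W) ∏ (1 + θ R^α ‖y‖^(-α))^(-m)` over the interferers `y`
(`measure_fading`, `IsModel.measure_forall_lt_SINR`). Infinite products are kept as `expNeg` of sums
in `[0, ∞]`, so no convergence question arises.

It remains to average over the locations. Instead of Palm calculus, the proof considers the law of
`R²` weighted by the conditional coverage (`coverageMass`) and bounds its mass on `[a, b)`. A
Laplace functional with exponent `∞` on a disc is restricted to the event that the disc is empty.
Hence the difference of two functionals, with `R² ≥ a` and with `R² ≥ b`, isolates the event `a ≤ R²
< b`. Freezing the distance in noise and attenuation at `√a` or `√b` gives an upper and a lower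
bound (`IsModel.coverageMass_Ico_le`, `IsModel.le_coverageMass_Ico`), explicit by
`IsModel.lintegral_expNeg_tsum`. Both vanish at `b = a` and have there the same derivative in `b`,
namely `π λ_n` times the integrand at `a`; `measureReal_Ioi_eq_integral` integrates this density.

The exponents are planar integrals of `1 - (1 + θ (‖y‖/√t)^(-α))^(-m)`. The substitution `v =
(‖y‖/√t)^(-α)` and the binomial expansion of `1 - (1 - u)^m` in `u = θv/(1 + θv)` turn them into
one-dimensional integrals. Other operators interfere from the whole plane, `v ∈ (0, ∞)`, which gives
Beta functions (`lintegral_beta`); the own operator interferes only from outside the disc of radius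
`√t`, `v ∈ (0, 1]`, which gives Euler's integral for the hypergeometric function
(`isHypergeometricContinuation_eulerIntegral`). -/

/-- The function `x ↦ e⁻ˣ` on `[0, ∞]`. -/
def expNeg (x : ℝ≥0∞) : ℝ≥0∞ := (EReal.exp x)⁻¹

theorem expNeg_zero : expNeg 0 = 1 := by simp [expNeg]

theorem expNeg_top : expNeg ∞ = 0 := by simp [expNeg]

theorem expNeg_ofReal {x : ℝ} (hx : 0 ≤ x) :
    expNeg (ENNReal.ofReal x) = ENNReal.ofReal (Real.exp (-x)) := by
  rw [expNeg, EReal.coe_ennreal_ofReal, max_eq_left hx, EReal.exp_coe, Real.exp_neg,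
    ENNReal.ofReal_inv_of_pos (Real.exp_pos x)]

theorem antitone_expNeg : Antitone expNeg := fun _ _ h =>
  ENNReal.inv_le_inv.2 (EReal.exp_monotone (EReal.coe_ennreal_le_coe_ennreal_iff.2 h))

theorem expNeg_le_one (x : ℝ≥0∞) : expNeg x ≤ 1 := by
  simpa [expNeg_zero] using antitone_expNeg (zero_le (a := x))

theorem expNeg_ne_top (x : ℝ≥0∞) : expNeg x ≠ ∞ :=
  ((expNeg_le_one x).trans_lt ENNReal.one_lt_top).ne

theorem continuous_expNeg : Continuous expNeg :=
  continuous_inv.comp (ENNReal.continuous_exp.comp continuous_coe_ennreal_ereal)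

theorem measurable_expNeg : Measurable expNeg := continuous_expNeg.measurable

theorem expNeg_add (x y : ℝ≥0∞) : expNeg (x + y) = expNeg x * expNeg y := by
  have h (z : ℝ≥0∞) : EReal.exp (z : EReal) ≠ 0 := by
    simp
  rw [expNeg, EReal.coe_ennreal_add, EReal.exp_add, ENNReal.mul_inv (Or.inl (h x)) (Or.inr (h y))]
  rfl

theorem expNeg_sum {ι : Type*} (s : Finset ι) (f : ι → ℝ≥0∞) :
    expNeg (∑ i ∈ s, f i) = ∏ i ∈ s, expNeg (f i) := by
  classical
  induction s using Finset.induction_on with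
  | empty => simp [expNeg_zero]
  | insert a s ha ih => rw [Finset.sum_insert ha, Finset.prod_insert ha, expNeg_add, ih]

theorem expNeg_mul_natCast (c : ℝ≥0∞) (m : ℕ) : expNeg (c * m) = expNeg c ^ m := by
  induction m with
  | zero => simp [expNeg_zero]
  | succ m ih => rw [Nat.cast_succ, mul_add, mul_one, expNeg_add, ih, pow_succ]

/-! ### The Laplace functional of a Poisson process -/

/-- The Poisson generating function. With `z = expNeg c` it is the Laplace transform of a count; `c
= ∞`, `z = 0` yields the void probability. -/
theorem lintegral_pow_poissonMeasure (r : NNReal) {z : ℝ≥0∞} (hz : z ≤ 1) :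
    ∫⁻ m, z ^ m ∂(poissonMeasure r) = expNeg (r * (1 - z)) := by
  have hz' : z ≠ ∞ := (hz.trans_lt ENNReal.one_lt_top).ne
  lift z to NNReal using hz'
  have hz1 : (z : ℝ) ≤ 1 := by exact_mod_cast hz
  have hs : HasSum (fun n : ℕ => Real.exp (-r) * ((r * z : ℝ) ^ n / n.factorial))
      (Real.exp (-(r * (1 - z)))) := by
    have h := (NormedSpace.expSeries_div_hasSum_exp (r * z : ℝ)).mul_left (Real.exp (-r))
    rw [← Real.exp_eq_exp_ℝ, ← Real.exp_add] at h
    rw [show -(r * (1 - z : ℝ)) = -r + r * z by ring]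
    exact h
  have e : (r : ℝ≥0∞) * (1 - z) = ENNReal.ofReal (r * (1 - z)) := by
    rw [ENNReal.ofReal_mul r.coe_nonneg, ENNReal.ofReal_sub _ z.coe_nonneg, ENNReal.ofReal_coe_nnreal,
      ENNReal.ofReal_coe_nnreal, ENNReal.ofReal_one]
  rw [e, expNeg_ofReal (mul_nonneg r.coe_nonneg (by linarith)), ← hs.tsum_eq,
    ENNReal.ofReal_tsum_of_nonneg (fun n => by positivity) hs.summable, poissonMeasure,
    lintegral_sum_measure]
  refine tsum_congr fun n => ?_
  rw [lintegral_smul_measure, lintegral_dirac, smul_eq_mul, ← ENNReal.ofReal_coe_nnreal,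
    ← ENNReal.ofReal_pow z.coe_nonneg, ← ENNReal.ofReal_mul (by positivity)]
  congr 1
  rw [mul_pow]
  ring

/-- The simple functions of bounded support that increase to `φ`. -/
def boundedApprox (φ : Plane → ℝ≥0∞) (m : ℕ) : SimpleFunc Plane ℝ≥0∞ :=
  (SimpleFunc.eapprox φ m).restrict (Metric.ball 0 m)

theorem monotone_boundedApprox (φ : Plane → ℝ≥0∞) (y : Plane) :
    Monotone fun m => boundedApprox φ m y := by
  intro m m' h
  simp only [boundedApprox, SimpleFunc.restrict_apply _ measurableSet_ball]
  refine (Set.indicator_le_indicator (SimpleFunc.monotone_eapprox φ h y)).trans ?_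
  exact Set.indicator_le_indicator_of_subset
    (Metric.ball_subset_ball (by exact_mod_cast h)) (fun _ => zero_le) y

theorem tendsto_boundedApprox {φ : Plane → ℝ≥0∞} (hφ : Measurable φ) (y : Plane) :
    Tendsto (fun m => boundedApprox φ m y) atTop (𝓝 (φ y)) := by
  refine (SimpleFunc.tendsto_eapprox hφ y).congr' ?_
  obtain ⟨k, hk⟩ := exists_nat_gt ‖y‖
  filter_upwards [eventually_ge_atTop k] with m hm
  have hm' : (k : ℝ) ≤ m := by exact_mod_cast hm
  rw [boundedApprox, SimpleFunc.restrict_apply _ measurableSet_ball, Set.indicator_of_mem]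
  simpa using hk.trans_le hm'

/-- Only sets of finite area have a prescribed count law. The restriction to a ball ensures that
just the level `0`, which carries no weight, can have infinite area. -/
theorem volume_boundedApprox_preimage_ne_top (φ : Plane → ℝ≥0∞) (m : ℕ) {c : ℝ≥0∞} (hc : c ≠ 0) :
    volume (boundedApprox φ m ⁻¹' {c}) ≠ ∞ := by
  refine ne_top_of_le_ne_top (measure_ball_lt_top (μ := volume) (x := (0 : Plane)) (r := m)).ne
    (measure_mono fun y hy => ?_)
  by_contra h
  simp only [boundedApprox, Set.mem_preimage, SimpleFunc.restrict_apply _ measurableSet_ball,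
    Set.indicator_of_notMem h, Set.mem_singleton_iff] at hy
  exact hc hy.symm

/-- The sum of `φ` over a point set, as a function of the numbers of points in Borel sets. -/
def countSum (φ : Plane → ℝ≥0∞) (v : {B : Set Plane // MeasurableSet B} → ℕ∞) : ℝ≥0∞ :=
  ⨆ m, ∑ c ∈ (boundedApprox φ m).range,
    c * (v ⟨boundedApprox φ m ⁻¹' {c}, SimpleFunc.measurableSet_fiber _ _⟩ : ℝ≥0∞)

/-- Independence of the networks is a statement about their count fields, so sums over a network
have to be measurable functions of the counts before independence applies to them. -/
theorem measurable_countSum (φ : Plane → ℝ≥0∞) : Measurable (countSum φ) := by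
  refine Measurable.iSup fun m => Finset.measurable_sum _ fun c _ => ?_
  exact (Measurable.comp (g := fun a : ℕ∞ => (a : ℝ≥0∞)) Measurable.of_discrete
    (measurable_pi_apply _)).const_mul c

/-- Both sides are the integral of `f` against the image of counting measure under `x`; injectivity
identifies numbers of indices with numbers of points. -/
theorem sum_mul_count_range {x : ℕ → Plane} (hx : Function.Injective x)
    (f : SimpleFunc Plane ℝ≥0∞) :
    ∑ c ∈ f.range, c * (count (Set.range x) (f ⁻¹' {c}) : ℝ≥0∞) = ∑' i, f (x i) := by
  rw [← lintegral_count, ← lintegral_map f.measurable (measurable_from_nat (f := x)),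
    SimpleFunc.lintegral_eq_lintegral, SimpleFunc.lintegral]
  refine Finset.sum_congr rfl fun c _ => ?_
  rw [Measure.map_apply measurable_from_nat (f.measurableSet_fiber c),
    Measure.count_apply (measurable_from_nat (f.measurableSet_fiber c)), count, Set.inter_comm,
    ← Set.image_preimage_eq_inter_range, hx.encard_image]

theorem tendsto_tsum_boundedApprox {φ : Plane → ℝ≥0∞} (hφ : Measurable φ) (x : ℕ → Plane) :
    Tendsto (fun m => ∑' i, boundedApprox φ m (x i)) atTop (𝓝 (∑' i, φ (x i))) := by
  simp only [← lintegral_count]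
  refine lintegral_tendsto_of_tendsto_of_monotone
    (fun m => (measurable_from_nat (f := fun i => boundedApprox φ m (x i))).aemeasurable)
    (ae_of_all _ fun i => monotone_boundedApprox φ (x i))
    (ae_of_all _ fun i => tendsto_boundedApprox hφ (x i))

theorem countSum_count_range {φ : Plane → ℝ≥0∞} (hφ : Measurable φ) {x : ℕ → Plane}
    (hx : Function.Injective x) :
    countSum φ (fun B => count (Set.range x) B.1) = ∑' i, φ (x i) := by
  simp only [countSum, sum_mul_count_range hx]
  refine tendsto_nhds_unique (tendsto_atTop_iSup fun m m' h => ?_) (tendsto_tsum_boundedApprox hφ x)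
  exact ENNReal.tsum_le_tsum fun i => monotone_boundedApprox φ (x i) h

section LaplaceFunctional

variable {Ω : Type*} [MeasurableSpace Ω] {P : Measure Ω} {Φ : Ω → Set Plane} {lam : ℝ}

theorem IsPoissonProcess.lintegral_expNeg_mul_count (hΦ : IsPoissonProcess P Φ lam)
    {B : Set Plane} (hB : MeasurableSet B) (hB' : volume B ≠ ∞) (c : ℝ≥0∞) :
    ∫⁻ ω, expNeg (c * (count (Φ ω) B : ℝ≥0∞)) ∂P =
      expNeg (ENNReal.ofReal lam * ((1 - expNeg c) * volume B)) := by
  have hmeas : Measurable fun a : ℕ∞ => expNeg (c * (a : ℝ≥0∞)) := Measurable.of_discrete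
  rw [← lintegral_map hmeas (hΦ.measurable_count B hB), (hΦ.law_count B hB hB').map_eq,
    lintegral_map hmeas Measurable.of_discrete]
  simp only [ENat.toENNReal_coe, expNeg_mul_natCast]
  rw [lintegral_pow_poissonMeasure _ (expNeg_le_one c)]
  congr 1
  rw [ENNReal.coe_mul, ENNReal.coe_toNNReal hB', ENNReal.ofReal, mul_assoc, mul_comm (volume B)]

theorem IsPoissonProcess.lintegral_expNeg_sum_count (hΦ : IsPoissonProcess P Φ lam)
    (φ : Plane → ℝ≥0∞) (m : ℕ) :
    ∫⁻ ω, expNeg (∑ c ∈ (boundedApprox φ m).range,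
        c * (count (Φ ω) (boundedApprox φ m ⁻¹' {c}) : ℝ≥0∞)) ∂P =
      expNeg (ENNReal.ofReal lam * ∫⁻ y, 1 - expNeg (boundedApprox φ m y)) := by
  set f := boundedApprox φ m with hf
  set s := f.range.erase 0 with hs
  have hsum (v : ℝ≥0∞ → ℝ≥0∞) : ∑ c ∈ f.range, c * v c = ∑ c ∈ s, c * v c := by
    refine (Finset.sum_subset (Finset.erase_subset _ _) fun c hc hc' => ?_).symm
    have : c = 0 := by
      by_contra h
      exact hc' (Finset.mem_erase.2 ⟨h, hc⟩)
    rw [this, zero_mul]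
  -- The nonzero level sets are disjoint, so their counts are independent and the expectation
  -- factors; they are indexed by `Fin` to match `indep_count`.
  let B : Fin s.card → Set Plane := fun i => f ⁻¹' {(s.equivFin.symm i : ℝ≥0∞)}
  have hB (i) : MeasurableSet (B i) := f.measurableSet_fiber _
  have hind : iIndepFun (fun i ω => count (Φ ω) (B i)) P := by
    refine hΦ.indep_count _ B hB fun i j hij => ?_
    refine Disjoint.preimage _ (Set.disjoint_singleton.2 fun h => hij ?_)
    exact s.equivFin.symm.injective (Subtype.ext h)
  have hfin (g : ℝ≥0∞ → ℝ≥0∞) : ∏ c ∈ s, g c = ∏ i, g (s.equivFin.symm i : ℝ≥0∞) := by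
    rw [← Finset.prod_coe_sort]
    exact (Equiv.prod_comp s.equivFin.symm fun c : s => g c).symm
  have hint : ∫⁻ y, 1 - expNeg (f y) = ∑ c ∈ s, (1 - expNeg c) * volume (f ⁻¹' {c}) := by
    have h0 : (fun c : ℝ≥0∞ => 1 - expNeg c) 0 = 0 := by simp [expNeg_zero]
    have h := SimpleFunc.lintegral_eq_lintegral (f.map fun c => 1 - expNeg c)
      (volume : Measure Plane)
    rw [SimpleFunc.map_lintegral] at h
    simp only [SimpleFunc.coe_map, Function.comp_apply] at h
    rw [h]
    refine (Finset.sum_subset (Finset.erase_subset _ _) fun c hc hc' => ?_).symm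
    have : c = 0 := by
      by_contra h
      exact hc' (Finset.mem_erase.2 ⟨h, hc⟩)
    rw [this, expNeg_zero, tsub_self, zero_mul]
  have hX : iIndepFun (fun i ω => expNeg ((s.equivFin.symm i : ℝ≥0∞) *
      (count (Φ ω) (B i) : ℝ≥0∞))) P :=
    hind.comp (fun i a => expNeg ((s.equivFin.symm i : ℝ≥0∞) * (a : ℝ≥0∞)))
      fun i => Measurable.of_discrete
  simp only [hsum (fun c => (count (Φ _) (f ⁻¹' {c}) : ℝ≥0∞)), expNeg_sum, hint, Finset.mul_sum,
    hfin]
  rw [lintegral_prod_eq_prod_lintegral_of_indepFun Finset.univ _ hX fun i =>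
    (Measurable.of_discrete (f := fun a : ℕ∞ => expNeg ((s.equivFin.symm i : ℝ≥0∞) *
      (a : ℝ≥0∞)))).comp (hΦ.measurable_count _ (hB i))]
  refine Finset.prod_congr rfl fun i _ => hΦ.lintegral_expNeg_mul_count (hB i) ?_ _
  exact volume_boundedApprox_preimage_ne_top φ m (Finset.ne_of_mem_erase (s.equivFin.symm i).2)

/-- The Laplace functional of a Poisson process. -/
theorem IsPoissonProcess.lintegral_expNeg_tsum [IsProbabilityMeasure P] {X : ℕ → Ω → Plane}
    (hX : ∀ i, Measurable (X i)) (hinj : ∀ᵐ ω ∂P, Function.Injective fun i => X i ω)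
    (hΦ : IsPoissonProcess P (fun ω => Set.range fun i => X i ω) lam)
    {φ : Plane → ℝ≥0∞} (hφ : Measurable φ) :
    ∫⁻ ω, expNeg (∑' i, φ (X i ω)) ∂P =
      expNeg (ENNReal.ofReal lam * ∫⁻ y, 1 - expNeg (φ y)) := by
  -- Simple approximations pass to the limit on the left by dominated convergence with bound `1`,
  -- and on the right by monotone convergence, since `1 - expNeg` is increasing.
  have h1 : Tendsto (fun m => ∫⁻ ω, expNeg (∑' i, boundedApprox φ m (X i ω)) ∂P) atTop
      (𝓝 (∫⁻ ω, expNeg (∑' i, φ (X i ω)) ∂P)) := by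
    refine tendsto_lintegral_of_dominated_convergence (fun _ => 1) (fun m => ?_)
      (fun m => ae_of_all _ fun ω => expNeg_le_one _) (by simp)
      (ae_of_all _ fun ω => (continuous_expNeg.tendsto _).comp
        (tendsto_tsum_boundedApprox hφ fun i => X i ω))
    exact measurable_expNeg.comp
      (Measurable.tsum fun i => (boundedApprox φ m).measurable.comp (hX i))
  have h2 : Tendsto (fun m => expNeg (ENNReal.ofReal lam *
      ∫⁻ y, 1 - expNeg (boundedApprox φ m y))) atTop
      (𝓝 (expNeg (ENNReal.ofReal lam * ∫⁻ y, 1 - expNeg (φ y)))) := by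
    refine (continuous_expNeg.tendsto _).comp (ENNReal.Tendsto.const_mul ?_
      (Or.inr ENNReal.ofReal_ne_top))
    refine lintegral_tendsto_of_tendsto_of_monotone (fun m => ?_)
      (ae_of_all _ fun y m m' h => ?_) (ae_of_all _ fun y => ?_)
    · exact (measurable_const.sub
        (measurable_expNeg.comp (boundedApprox φ m).measurable)).aemeasurable
    · exact tsub_le_tsub_left (antitone_expNeg (monotone_boundedApprox φ y h)) 1
    · exact ENNReal.Tendsto.sub tendsto_const_nhds
        ((continuous_expNeg.tendsto _).comp (tendsto_boundedApprox hφ y)) (Or.inl ENNReal.one_ne_top)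
  refine tendsto_nhds_unique h1 (h2.congr fun m => ?_)
  rw [← hΦ.lintegral_expNeg_sum_count φ m]
  refine lintegral_congr_ae ?_
  filter_upwards [hinj] with ω hω
  rw [sum_mul_count_range hω]

variable {N : Type*} [Fintype N] {lam : N → ℝ} {X : N → ℕ → Ω → Plane} {h : N → ℕ → N → Ω → ℝ}

/-- The joint Laplace functional of the networks. -/
theorem IsModel.lintegral_expNeg_tsum [IsProbabilityMeasure P] (hM : IsModel P lam X h)
    {ψ : N → Plane → ℝ≥0∞} (hψ : ∀ j, Measurable (ψ j)) :
    ∫⁻ ω, expNeg (∑' p : N × ℕ, ψ p.1 (X p.1 p.2 ω)) ∂P =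
      expNeg (∑ j, ENNReal.ofReal (lam j) * ∫⁻ y, 1 - expNeg (ψ j y)) := by
  have hind : iIndepFun (fun j ω => expNeg (countSum (ψ j)
      fun B : {B : Set Plane // MeasurableSet B} => count (network X j ω) B.1)) P :=
    hM.indep_network.comp (fun j v => expNeg (countSum (ψ j) v))
      fun j => measurable_expNeg.comp (measurable_countSum _)
  have hcs (j : N) : ∀ᵐ ω ∂P, countSum (ψ j)
      (fun B : {B : Set Plane // MeasurableSet B} => count (network X j ω) B.1) =
        ∑' i, ψ j (X j i ω) := by
    filter_upwards [hM.injective_location j] with ω hω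
    exact countSum_count_range (hψ j) hω
  calc
    _ = ∫⁻ ω, ∏ j, expNeg (countSum (ψ j)
          fun B : {B : Set Plane // MeasurableSet B} => count (network X j ω) B.1) ∂P := by
      refine lintegral_congr_ae ?_
      filter_upwards [ae_all_iff.2 hcs] with ω hω
      simp only [hω]
      rw [ENNReal.tsum_prod' , tsum_fintype, expNeg_sum]
    _ = _ := by
      rw [lintegral_prod_eq_prod_lintegral_of_indepFun Finset.univ _ hind, expNeg_sum]
      · refine Finset.prod_congr rfl fun j _ => ?_
        rw [← (hM.poisson j).lintegral_expNeg_tsum (hM.measurable_location j)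
          (hM.injective_location j) (hψ j)]
        refine lintegral_congr_ae ?_
        filter_upwards [hcs j] with ω hω
        rw [hω]
      · intro j
        refine measurable_expNeg.comp ((measurable_countSum _).comp ?_)
        exact measurable_pi_lambda _ fun B => (hM.poisson j).measurable_count _ B.2

end LaplaceFunctional

/-! ### Exponential random variables -/

section Exponential

/-- The exponential tail. The value `t = ∞` is included because the interference is a sum in `[0,
∞]`. -/
theorem expMeasure_lt_ofReal (t : ℝ≥0∞) :
    expMeasure 1 {x | t < ENNReal.ofReal x} = expNeg t := by
  have : IsProbabilityMeasure (expMeasure 1) := isProbabilityMeasure_expMeasure one_pos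
  induction t with
  | top => simp [expNeg_top]
  | coe t =>
    have h : {x : ℝ | (t : ℝ≥0∞) < ENNReal.ofReal x} = (Set.Iic (t : ℝ))ᶜ := by
      ext x
      rw [Set.mem_compl_iff, Set.mem_Iic, not_le, Set.mem_ofPred_eq, ← ENNReal.ofReal_coe_nnreal,
        ENNReal.ofReal_lt_ofReal_iff']
      exact ⟨fun h => h.1, fun h => ⟨h, t.coe_nonneg.trans_lt h⟩⟩
    rw [h, measure_compl measurableSet_Iic (measure_ne_top _ _), measure_univ, ← ofReal_cdf,
      cdf_expMeasure_eq one_pos, if_pos t.coe_nonneg, ← ENNReal.ofReal_coe_nnreal,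
      expNeg_ofReal t.coe_nonneg, one_mul, ← ENNReal.ofReal_one, ← ENNReal.ofReal_sub, sub_sub_cancel]
    simp

/-- The Laplace transform `1/(1 + c)`, written as `expNeg` of a logarithm so that products over
transmitters become sums in the exponent. -/
theorem lintegral_expNeg_expMeasure {c : ℝ} (hc : 0 ≤ c) :
    ∫⁻ x, expNeg (ENNReal.ofReal (c * x)) ∂(expMeasure 1) =
      expNeg (ENNReal.ofReal (Real.log (1 + c))) := by
  have h1 : (0 : ℝ) < 1 + c := by linarith
  have hm : Measurable fun x : ℝ => expNeg (ENNReal.ofReal (c * x)) :=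
    measurable_expNeg.comp (by fun_prop)
  have hp (r : ℝ) : Measurable (exponentialPDF r) :=
    (measurable_exponentialPDFReal r).ennreal_ofReal
  -- Exponential tilting: `e^(-cx)` times the density of rate `1` is `(1 + c)⁻¹` times the density
  -- of rate `1 + c`.
  have e : ∀ x, (exponentialPDF 1 * fun x : ℝ => expNeg (ENNReal.ofReal (c * x))) x =
      ENNReal.ofReal (1 + c)⁻¹ * exponentialPDF (1 + c) x := by
    intro x
    rw [Pi.mul_apply]
    rcases lt_or_ge x 0 with hx | hx
    · simp [exponentialPDF_of_neg hx]
    · rw [exponentialPDF_of_nonneg hx, exponentialPDF_of_nonneg hx,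
        expNeg_ofReal (mul_nonneg hc hx), ← ENNReal.ofReal_mul (by positivity),
        ← ENNReal.ofReal_mul (by positivity)]
      congr 1
      rw [one_mul, one_mul, ← Real.exp_add, inv_mul_cancel_left₀ h1.ne']
      congr 1
      ring
  have hd : expMeasure 1 = volume.withDensity (exponentialPDF 1) := rfl
  rw [hd, lintegral_withDensity_eq_lintegral_mul _ (hp 1) hm, lintegral_congr e,
    lintegral_const_mul _ (hp _), lintegral_exponentialPDF_eq_one h1, mul_one,
    expNeg_ofReal (Real.log_nonneg (by linarith)), Real.exp_neg, Real.exp_log h1]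

end Exponential

/-! ### Independence -/

section Independence

variable {Ω : Type*} [MeasurableSpace Ω] {P : Measure Ω}

/-- Fubini for the product law. This replaces conditioning on `f`: its value is frozen at `ω` while
`g` is resampled at `ω'`. -/
theorem measure_mem_of_indepFun [IsProbabilityMeasure P] {β γ : Type*} [MeasurableSpace β]
    [MeasurableSpace γ] {f : Ω → β} {g : Ω → γ} (hf : Measurable f) (hg : Measurable g)
    (hfg : IndepFun f g P) {D : Set (β × γ)} (hD : MeasurableSet D) :
    P {ω | (f ω, g ω) ∈ D} = ∫⁻ ω, P {ω' | (f ω, g ω') ∈ D} ∂P := by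
  have : IsProbabilityMeasure (P.map g) := Measure.isProbabilityMeasure_map hg.aemeasurable
  calc
    P {ω | (f ω, g ω) ∈ D} = P.map (fun ω => (f ω, g ω)) D :=
      (Measure.map_apply (hf.prodMk hg) hD).symm
    _ = ∫⁻ x, P.map g (Prod.mk x ⁻¹' D) ∂(P.map f) := by
      rw [hfg.map_prod_eq_prod_map_map hf.aemeasurable hg.aemeasurable, Measure.prod_apply hD]
    _ = _ := by
      rw [lintegral_map (measurable_measure_prodMk_left hD) hf]
      refine lintegral_congr fun ω => ?_
      rw [Measure.map_apply hg (measurable_prodMk_left hD)]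
      rfl

theorem lintegral_expNeg_tsum_of_iIndepFun [IsProbabilityMeasure P] {ι : Type*} [Countable ι]
    {Z : ι → Ω → ℝ≥0∞} {a : ι → ℝ≥0∞} (hZ : ∀ i, Measurable (Z i)) (hind : iIndepFun Z P)
    (ha : ∀ i, ∫⁻ ω, expNeg (Z i ω) ∂P = expNeg (a i)) :
    ∫⁻ ω, expNeg (∑' i, Z i ω) ∂P = expNeg (∑' i, a i) := by
  have hX : iIndepFun (fun i ω => expNeg (Z i ω)) P :=
    hind.comp (fun _ => expNeg) fun _ => measurable_expNeg
  have h1 : Tendsto (fun s : Finset ι => ∫⁻ ω, expNeg (∑ i ∈ s, Z i ω) ∂P) atTop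
      (𝓝 (∫⁻ ω, expNeg (∑' i, Z i ω) ∂P)) := by
    refine tendsto_lintegral_filter_of_dominated_convergence (fun _ => 1)
      (Eventually.of_forall fun s => ?_)
      (Eventually.of_forall fun s => ae_of_all _ fun ω => expNeg_le_one _) (by simp)
      (ae_of_all _ fun ω => (continuous_expNeg.tendsto _).comp ENNReal.summable.hasSum)
    exact measurable_expNeg.comp (Finset.measurable_sum _ fun i _ => hZ i)
  have h2 : Tendsto (fun s : Finset ι => expNeg (∑ i ∈ s, a i)) atTop (𝓝 (expNeg (∑' i, a i))) :=
    (continuous_expNeg.tendsto _).comp ENNReal.summable.hasSum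
  refine tendsto_nhds_unique h1 (h2.congr fun s => ?_)
  simp only [expNeg_sum]
  rw [lintegral_prod_eq_prod_lintegral_of_indepFun s _ hX fun i => measurable_expNeg.comp (hZ i)]
  exact Finset.prod_congr rfl fun i _ => (ha i).symm

/-- Rayleigh fading: the probability that the exponential fading variables of a transmitter `i₀`
exceed noise plus weighted sums of the fading variables of the other transmitters in all of
the bands of `S`. -/
theorem measure_fading [IsProbabilityMeasure P] {ι K : Type*} [Countable ι] [Fintype K]
    [DecidableEq ι] [DecidableEq K] {H : ι → K → Ω → ℝ} (hH : ∀ i k, Measurable (H i k))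
    (hlaw : ∀ i k, HasLaw (H i k) (expMeasure 1) P)
    (hind : iIndepFun (fun (q : ι × K) ω => H q.1 q.2 ω) P) (i₀ : ι) (a : ℝ)
    {c : ι → ℝ} (hc : ∀ i, 0 ≤ c i) (S : Finset K) :
    P {ω | ∀ k ∈ S, ENNReal.ofReal a +
        ∑' i, (if i = i₀ then 0 else ENNReal.ofReal (c i * H i k ω)) <
          ENNReal.ofReal (H i₀ k ω)} =
      expNeg (ENNReal.ofReal (S.card * a) +
        ∑' i, if i = i₀ then 0 else ENNReal.ofReal (S.card * Real.log (1 + c i))) := by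
  set T : Ω → K → ℝ≥0∞ := fun ω k => ENNReal.ofReal a +
    ∑' i, (if i = i₀ then 0 else ENNReal.ofReal (c i * H i k ω)) with hT
  set U : Ω → K → ℝ := fun ω k => H i₀ k ω with hU
  have hTm : Measurable T := by
    refine measurable_pi_lambda _ fun k => ?_
    simp only [hT]
    refine Measurable.const_add ?_ _
    refine Measurable.tsum fun i => ?_
    split_ifs
    · exact measurable_const
    · exact ((hH i k).const_mul _).ennreal_ofReal
  have hUm : Measurable U := measurable_pi_lambda _ fun k => hH i₀ k
  -- The thresholds `T` involve only transmitters other than `i₀`, the signal `U` only `i₀`: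
  -- disjoint blocks of one independent family.
  have hTU : IndepFun T U P := by
    have hd : Disjoint {q : ι × K | q.1 ≠ i₀} {q : ι × K | q.1 = i₀} :=
      Set.disjoint_left.2 fun q h h' => h h'
    have h := indep_iSup_of_disjoint (fun q : ι × K => (hH q.1 q.2).comap_le) hind hd
    refine indep_of_indep_of_le_left (indep_of_indep_of_le_right h ?_) ?_
    · refine Measurable.comap_le ?_
      refine @measurable_pi_lambda _ _ _ (_) _ _ fun k => ?_
      refine Measurable.mono (comap_measurable (H i₀ k)) ?_ le_rfl
      exact le_iSup₂_of_le (i₀, k) rfl le_rfl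
    · refine Measurable.comap_le ?_
      refine @measurable_pi_lambda _ _ _ (_) _ _ fun k => ?_
      simp only [hT]
      refine Measurable.const_add ?_ _
      refine @Measurable.tsum _ _ _ (_) _ _ _ _ _ _ _ _ _ _ _ _ fun i => ?_
      split_ifs with hi
      · exact measurable_const
      · refine Measurable.mono ((Measurable.const_mul (comap_measurable (H i k))
          (c i)).ennreal_ofReal) ?_ le_rfl
        exact le_iSup₂_of_le (i, k) hi le_rfl
  set D : Set ((K → ℝ≥0∞) × (K → ℝ)) := {z | ∀ k ∈ S, z.1 k < ENNReal.ofReal (z.2 k)} with hD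
  have hDm : MeasurableSet D := by
    have : D = ⋂ k ∈ S, {z | z.1 k < ENNReal.ofReal (z.2 k)} := by
      ext z
      simp [hD]
    rw [this]
    refine Finset.measurableSet_biInter _ fun k _ => measurableSet_lt ?_ ?_
    · exact (measurable_pi_apply k).comp measurable_fst
    · exact ((measurable_pi_apply k).comp measurable_snd).ennreal_ofReal
  -- With the thresholds frozen, the signal exceeds them independently in the bands, with
  -- probability `expNeg (T ω k)` each.
  have h1 : P {ω | ∀ k ∈ S, T ω k < ENNReal.ofReal (H i₀ k ω)} =
      ∫⁻ ω, expNeg (∑ k ∈ S, T ω k) ∂P := by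
    change P {ω | (T ω, U ω) ∈ D} = _
    rw [measure_mem_of_indepFun hTm hUm hTU hDm]
    refine lintegral_congr fun ω => ?_
    have hset : {ω' | (T ω, U ω') ∈ D} =
        ⋂ k ∈ S, H i₀ k ⁻¹' {x | T ω k < ENNReal.ofReal x} := by
      ext ω'
      simp [hD, hU]
    have hmeas (k) : MeasurableSet {x : ℝ | T ω k < ENNReal.ofReal x} :=
      measurableSet_lt measurable_const ENNReal.measurable_ofReal
    have hind' : iIndepFun (fun k ω => H i₀ k ω) P :=
      hind.precomp (g := fun k => (i₀, k)) fun k k' h => (Prod.ext_iff.1 h).2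
    rw [hset, hind'.measure_inter_preimage_eq_mul S fun k _ => hmeas k, expNeg_sum]
    refine Finset.prod_congr rfl fun k _ => ?_
    rw [← expMeasure_lt_ofReal, ← (hlaw i₀ k).map_eq, Measure.map_apply (hH i₀ k) (hmeas k)]
  -- All bands are flattened into one independent family, so that the sum over bands and interferers
  -- has a Laplace transform in product form.
  let Z : ι × K → Ω → ℝ≥0∞ := fun q ω =>
    if q.2 ∈ S ∧ q.1 ≠ i₀ then ENNReal.ofReal (c q.1 * H q.1 q.2 ω) else 0
  let b : ι × K → ℝ≥0∞ := fun q =>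
    if q.2 ∈ S ∧ q.1 ≠ i₀ then ENNReal.ofReal (Real.log (1 + c q.1)) else 0
  have hsum (u : ι → K → ℝ≥0∞) : ∑' q : ι × K, (if q.2 ∈ S ∧ q.1 ≠ i₀ then u q.1 q.2 else 0) =
      ∑ k ∈ S, ∑' i, if i = i₀ then 0 else u i k := by
    have h' (i : ι) (k : K) : (if k ∈ S ∧ i ≠ i₀ then u i k else 0) =
        if k ∈ S then (if i = i₀ then 0 else u i k) else 0 := by
      by_cases hk : k ∈ S <;> by_cases hi : i = i₀ <;> simp [hk, hi]
    rw [ENNReal.tsum_prod', ENNReal.tsum_comm, tsum_fintype]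
    simp only [h']
    rw [← Finset.sum_filter_add_sum_filter_not Finset.univ (· ∈ S)]
    rw [Finset.sum_congr rfl (g := fun k => ∑' i, if i = i₀ then 0 else u i k),
      Finset.sum_eq_zero (s := Finset.univ.filter (· ∉ S)), add_zero]
    · simp
    · intro k hk
      simp [(Finset.mem_filter.1 hk).2]
    · intro k hk
      simp [(Finset.mem_filter.1 hk).2]
  have hZm (q) : Measurable (Z q) := by
    simp only [Z]
    split_ifs
    · exact ((hH q.1 q.2).const_mul _).ennreal_ofReal
    · exact measurable_const
  have hZi : iIndepFun Z P := by
    refine hind.comp (fun q x => if q.2 ∈ S ∧ q.1 ≠ i₀ then ENNReal.ofReal (c q.1 * x) else 0)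
      fun q => ?_
    split_ifs
    · fun_prop
    · exact measurable_const
  have hZb (q) : ∫⁻ ω, expNeg (Z q ω) ∂P = expNeg (b q) := by
    simp only [Z, b]
    split_ifs
    · rw [← lintegral_expNeg_expMeasure (hc q.1), ← (hlaw q.1 q.2).map_eq,
        lintegral_map (f := fun x => expNeg (ENNReal.ofReal (c q.1 * x)))
          (measurable_expNeg.comp (by fun_prop)) (hH q.1 q.2)]
    · simp [expNeg_zero]
  have hT' (ω : Ω) : ∑ k ∈ S, T ω k = ENNReal.ofReal (S.card * a) + ∑' q, Z q ω := by
    simp only [hT, Z]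
    rw [Finset.sum_add_distrib, Finset.sum_const, nsmul_eq_mul,
      ENNReal.ofReal_mul (Nat.cast_nonneg _), ENNReal.ofReal_natCast,
      hsum fun i k => ENNReal.ofReal (c i * H i k ω)]
  rw [h1]
  simp only [hT', expNeg_add]
  rw [lintegral_const_mul' _ _ (expNeg_ne_top _), lintegral_expNeg_tsum_of_iIndepFun hZm hZi hZb]
  congr 2
  simp only [b]
  rw [hsum fun i _ => ENNReal.ofReal (Real.log (1 + c i)), Finset.sum_const, nsmul_eq_mul,
    ← ENNReal.tsum_mul_left]
  refine tsum_congr fun i => ?_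
  split_ifs
  · simp
  · rw [ENNReal.ofReal_mul (Nat.cast_nonneg _), ENNReal.ofReal_natCast]

end Independence

/-! ### The coverage event given the locations -/

section Coverage

variable {Ω N : Type*}

section Measurability

variable [MeasurableSpace Ω] {X : N → ℕ → Ω → Plane} {h : N → ℕ → N → Ω → ℝ}

theorem measurable_serving (hX : ∀ j i, Measurable (X j i)) (n : N) :
    Measurable (serving X n) := by
  have hm (i : ℕ) : MeasurableSet {ω | ∀ i', ‖X n i ω‖ ≤ ‖X n i' ω‖} := by
    have : {ω | ∀ i', ‖X n i ω‖ ≤ ‖X n i' ω‖} = ⋂ i', {ω | ‖X n i ω‖ ≤ ‖X n i' ω‖} := by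
      ext
      simp
    rw [this]
    exact MeasurableSet.iInter fun i' => measurableSet_le (hX n i).norm (hX n i').norm
  refine measurable_of_Iic fun b => ?_
  -- Since `sInf ∅ = 0`, the event that no closest transmitter exists lies in every set `serving ≤
  -- b`.
  have : serving X n ⁻¹' Set.Iic b =
      (⋃ i ∈ Set.Iic b, {ω | ∀ i', ‖X n i ω‖ ≤ ‖X n i' ω‖}) ∪
        ⋂ i, {ω | ∀ i', ‖X n i ω‖ ≤ ‖X n i' ω‖}ᶜ := by
    ext ω
    simp only [Set.mem_preimage, Set.mem_Iic, Set.mem_union, Set.mem_iUnion, Set.mem_iInter,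
      Set.mem_compl_iff, exists_prop]
    constructor
    · intro hs
      by_cases he : ∃ i, ∀ i', ‖X n i ω‖ ≤ ‖X n i' ω‖
      · exact Or.inl ⟨_, hs, Nat.sInf_mem (s := {i | ∀ i', ‖X n i ω‖ ≤ ‖X n i' ω‖}) he⟩
      · exact Or.inr fun i hi => he ⟨i, hi⟩
    · rintro (⟨i, hib, hi⟩ | he)
      · exact (Nat.sInf_le hi).trans hib
      · have : {i | ∀ i', ‖X n i ω‖ ≤ ‖X n i' ω‖} = ∅ := Set.eq_empty_of_forall_notMem he
        simp [serving, this]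
  rw [this]
  exact (MeasurableSet.biUnion (Set.to_countable _) fun i _ => hm i).union
    (MeasurableSet.iInter fun i => (hm i).compl)

theorem measurable_serving_apply {β : Type*} [MeasurableSpace β]
    (hX : ∀ j i, Measurable (X j i)) (n : N) {f : ℕ → Ω → β} (hf : ∀ i, Measurable (f i)) :
    Measurable fun ω => f (serving X n ω) ω :=
  (measurable_from_prod_countable_right (f := fun p : ℕ × Ω => f p.1 p.2) hf).comp
    ((measurable_serving hX n).prodMk measurable_id)

theorem measurable_power (hX : ∀ j i, Measurable (X j i)) (hh : ∀ j i k, Measurable (h j i k))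
    (α : ℝ) (j : N) (i : ℕ) (k : N) : Measurable (power α X h j i k) :=
  (hh j i k).mul ((hX j i).norm.pow_const _)

theorem measurable_tsum_ite_serving [DecidableEq N] [Countable N]
    (hX : ∀ j i, Measurable (X j i)) (n : N) {f : N × ℕ → Ω → ℝ≥0∞} (hf : ∀ p, Measurable (f p)) :
    Measurable fun ω => ∑' p, if p = (n, serving X n ω) then 0 else f p ω := by
  refine Measurable.tsum fun p => ?_
  refine measurable_serving_apply hX n (f := fun i ω => if p = (n, i) then 0 else f p ω) fun i => ?_
  split_ifs
  · exact measurable_const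
  · exact hf p

end Measurability

theorem interference_eq [DecidableEq N] (α : ℝ) (X : N → ℕ → Ω → Plane)
    (h : N → ℕ → N → Ω → ℝ) (n k : N) (ω : Ω) :
    interference α X h n k ω = ∑' p : N × ℕ, if p = (n, serving X n ω) then 0 else
      ENNReal.ofReal (power α X h p.1 p.2 k ω) := by
  refine (tsum_subtype {p : N × ℕ | p ≠ (n, serving X n ω)}
    fun p => ENNReal.ofReal (power α X h p.1 p.2 k ω)).trans ?_
  refine tsum_congr fun p => ?_
  by_cases hp : p = (n, serving X n ω) <;> simp [hp]

theorem measurable_SINR [MeasurableSpace Ω] [Countable N] {X : N → ℕ → Ω → Plane}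
    {h : N → ℕ → N → Ω → ℝ} (hX : ∀ j i, Measurable (X j i)) (hh : ∀ j i k, Measurable (h j i k))
    (α W η : ℝ) (n k : N) : Measurable (SINR α W η X h n k) := by
  classical
  have hp := measurable_power hX hh α
  refine Measurable.div (measurable_serving_apply hX n fun i => (hp n i k).ennreal_ofReal) ?_
  simp only [funext (interference_eq α X h n k)]
  exact Measurable.const_add (measurable_tsum_ite_serving hX n
    fun p => (hp p.1 p.2 k).ennreal_ofReal) _

theorem lt_SINR_iff [DecidableEq N] {α W η θ : ℝ} (hθ : 0 < θ)
    (X : N → ℕ → Ω → Plane) (h : N → ℕ → N → Ω → ℝ) (n k : N) (ω : Ω)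
    (hR : 0 < ‖X n (serving X n ω) ω‖) :
    ENNReal.ofReal θ < SINR α W η X h n k ω ↔
      ENNReal.ofReal (θ * ‖X n (serving X n ω) ω‖ ^ α * (η * W)) +
        ∑' p : N × ℕ, (if p = (n, serving X n ω) then 0 else ENNReal.ofReal
          (θ * ‖X n (serving X n ω) ω‖ ^ α * ‖X p.1 p.2 ω‖ ^ (-α) * h p.1 p.2 k ω)) <
        ENNReal.ofReal (h n (serving X n ω) k ω) := by
  set s := serving X n ω
  set R := ‖X n s ω‖
  set r : ℝ≥0∞ := ENNReal.ofReal (R ^ α) with hr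
  have hRα : 0 < R ^ α := Real.rpow_pos_of_pos hR α
  have hr0 : r ≠ 0 := by simpa [hr] using hRα
  have hrt : r ≠ ∞ := ENNReal.ofReal_ne_top
  set D := ENNReal.ofReal (η * W) + interference α X h n k ω with hD
  have hpow : ENNReal.ofReal (power α X h n s k ω) = ENNReal.ofReal (h n s k ω) / r := by
    rw [power, Real.rpow_neg hR.le, ← div_eq_mul_inv, ENNReal.ofReal_div_of_pos hRα]
  have hsum : ENNReal.ofReal (θ * R ^ α * (η * W)) +
        ∑' p : N × ℕ, (if p = (n, s) then 0 else ENNReal.ofReal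
          (θ * R ^ α * ‖X p.1 p.2 ω‖ ^ (-α) * h p.1 p.2 k ω)) = ENNReal.ofReal θ * D * r := by
    have ht : ENNReal.ofReal (θ * R ^ α) = ENNReal.ofReal θ * r := ENNReal.ofReal_mul hθ.le
    rw [hD, mul_right_comm (ENNReal.ofReal θ), ← ht, mul_add, interference_eq, ← ENNReal.tsum_mul_left,
      ENNReal.ofReal_mul (by positivity)]
    congr 1
    refine tsum_congr fun p => ?_
    split_ifs
    · simp
    · rw [← ENNReal.ofReal_mul (by positivity), power]
      congr 1
      ring
  rw [hsum, SINR, ← hD, hpow]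
  have hθ0 : ENNReal.ofReal θ ≠ 0 := by simpa using hθ
  -- The degenerate denominators agree with the claim: for `D = 0` both sides say that the signal is
  -- nonzero, for `D = ∞` both are false.
  have key : ENNReal.ofReal θ < ENNReal.ofReal (h n s k ω) / r / D ↔
      ENNReal.ofReal θ * D < ENNReal.ofReal (h n s k ω) / r := by
    rcases eq_or_ne D 0 with h0 | h0
    · rw [h0, mul_zero]
      rcases eq_or_ne (ENNReal.ofReal (h n s k ω) / r) 0 with h1 | h1
      · simp [h1]
      · simp [ENNReal.div_zero h1, pos_iff_ne_zero, h1]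
    rcases eq_or_ne D ∞ with h1 | h1
    · simp [h1, ENNReal.mul_top hθ0]
    · exact ENNReal.lt_div_iff_mul_lt (Or.inl h0) (Or.inl h1)
  rw [key, ENNReal.lt_div_iff_mul_lt (Or.inl hr0) (Or.inl hrt)]

/-- The conditional probability, given the locations, that the SINR exceeds the threshold `θ` in
each of `m` given bands. -/
def conditionalCoverage [DecidableEq N] (α W η θ : ℝ) (X : N → ℕ → Ω → Plane) (n : N) (m : ℕ)
    (ω : Ω) : ℝ≥0∞ :=
  expNeg (ENNReal.ofReal (m * (θ * ‖X n (serving X n ω) ω‖ ^ α * (η * W))) +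
    ∑' p : N × ℕ, if p = (n, serving X n ω) then 0 else ENNReal.ofReal
      (m * Real.log (1 + θ * ‖X n (serving X n ω) ω‖ ^ α * ‖X p.1 p.2 ω‖ ^ (-α))))

variable [MeasurableSpace Ω] {P : Measure Ω}
  {lam : N → ℝ} {X : N → ℕ → Ω → Plane} {h : N → ℕ → N → Ω → ℝ}

theorem IsPoissonProcess.ae_count_eq_zero [IsProbabilityMeasure P] {Φ : Ω → Set Plane} {lam : ℝ}
    (hΦ : IsPoissonProcess P Φ lam) {B : Set Plane} (hB : MeasurableSet B) (hB' : volume B = 0) :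
    ∀ᵐ ω ∂P, count (Φ ω) B = 0 := by
  -- With `c = ∞` the Laplace transform is the probability of a zero count.
  have hl := hΦ.lintegral_expNeg_mul_count hB (by simp [hB']) ∞
  have hc (a : ℕ∞) : expNeg (∞ * (a : ℝ≥0∞)) = if a = 0 then 1 else 0 := by
    split_ifs with ha
    · simp [ha, expNeg_zero]
    · rw [ENNReal.top_mul (by simpa using ha), expNeg_top]
  simp only [hB', mul_zero, expNeg_zero, hc] at hl
  have hm : MeasurableSet {ω | count (Φ ω) B = 0} :=
    hΦ.measurable_count B hB (measurableSet_singleton 0)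
  rw [show (fun ω => if count (Φ ω) B = 0 then (1 : ℝ≥0∞) else 0) =
    {ω | count (Φ ω) B = 0}.indicator 1 from
      funext fun ω => by simp [Set.indicator_apply], lintegral_indicator_one hm] at hl
  exact (prob_compl_eq_zero_iff hm).2 hl

theorem IsPoissonProcess.ae_count_ne_top {Φ : Ω → Set Plane} {lam : ℝ}
    (hΦ : IsPoissonProcess P Φ lam) {B : Set Plane} (hB : MeasurableSet B) (hB' : volume B ≠ ∞) :
    ∀ᵐ ω ∂P, count (Φ ω) B ≠ ⊤ := by
  have hl := (hΦ.law_count B hB hB').map_eq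
  have h0 : P.map (fun ω => count (Φ ω) B) {⊤} = 0 := by
    rw [hl, Measure.map_apply Measurable.of_discrete (measurableSet_singleton _)]
    rw [show (fun m : ℕ => (m : ℕ∞)) ⁻¹' {⊤} = ∅ by ext; simp, measure_empty]
  rw [Measure.map_apply (hΦ.measurable_count B hB) (measurableSet_singleton _)] at h0
  exact measure_eq_zero_iff_ae_notMem.1 h0

theorem IsModel.ae_ne_zero [IsProbabilityMeasure P] (hM : IsModel P lam X h) (j : N) : ∀ᵐ ω ∂P, ∀ i, X j i ω ≠ 0 := by
  filter_upwards [(hM.poisson j).ae_count_eq_zero (measurableSet_singleton 0) (by simp)]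
    with ω hω i hi
  rw [count, Set.encard_eq_zero] at hω
  exact Set.notMem_empty (0 : Plane) (hω ▸ ⟨⟨i, hi⟩, rfl⟩)

/-- Almost surely every disc of integer radius contains finitely many transmitters, so the minimal
distance is attained. -/
theorem IsModel.ae_serving_spec (hM : IsModel P lam X h) (n : N) :
    ∀ᵐ ω ∂P, ∀ i, ‖X n (serving X n ω) ω‖ ≤ ‖X n i ω‖ := by
  have hb : ∀ᵐ ω ∂P, ∀ m : ℕ, count (network X n ω) (Metric.closedBall 0 m) ≠ ⊤ :=
    ae_all_iff.2 fun m => (hM.poisson n).ae_count_ne_top measurableSet_closedBall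
      measure_closedBall_lt_top.ne
  filter_upwards [hb, hM.injective_location n] with ω hω hinj
  refine Nat.sInf_mem (s := {i | ∀ i', ‖X n i ω‖ ≤ ‖X n i' ω‖}) ?_
  obtain ⟨m, hm⟩ := exists_nat_ge ‖X n 0 ω‖
  have hfin : {i | ‖X n i ω‖ ≤ m}.Finite := by
    refine Set.Finite.of_finite_image ((Set.encard_ne_top_iff.1 (hω m)).subset ?_) hinj.injOn
    rintro _ ⟨i, hi, rfl⟩
    exact ⟨⟨i, rfl⟩, by simpa using hi⟩
  obtain ⟨i, hi, hmin⟩ := Set.exists_min_image _ (fun i => ‖X n i ω‖) hfin ⟨0, hm⟩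
  refine ⟨i, fun i' => ?_⟩
  by_cases hi' : ‖X n i' ω‖ ≤ m
  · exact hmin i' hi'
  · exact le_trans hi (not_le.1 hi').le

/-- The probability that the SINR exceeds the threshold in all bands of `S`. -/
theorem IsModel.measure_forall_lt_SINR [IsProbabilityMeasure P] [Fintype N] [DecidableEq N] (hM : IsModel P lam X h) {α W η θ : ℝ} (hθ : 0 < θ)
    (n : N) (S : Finset N) :
    P {ω | ∀ k ∈ S, ENNReal.ofReal θ < SINR α W η X h n k ω} =
      ∫⁻ ω, conditionalCoverage α W η θ X n S.card ω ∂P := by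
  -- On the canonical space of locations and fading the SINR can be evaluated at the locations of
  -- one `ω` and the fading of another.
  let Ω' := (N × ℕ → Plane) × (N × ℕ × N → ℝ)
  let X' : N → ℕ → Ω' → Plane := fun j i z => z.1 (j, i)
  let h' : N → ℕ → N → Ω' → ℝ := fun j i k z => z.2 (j, i, k)
  have hX' (j i) : Measurable (X' j i) := (measurable_pi_apply _).comp measurable_fst
  have hh' (j i k) : Measurable (h' j i k) := (measurable_pi_apply _).comp measurable_snd
  let f : Ω → N × ℕ → Plane := fun ω p => X p.1 p.2 ω
  let g : Ω → N × ℕ × N → ℝ := fun ω p => h p.1 p.2.1 p.2.2 ω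
  have hf : Measurable f := measurable_pi_lambda _ fun p => hM.measurable_location _ _
  have hg : Measurable g := measurable_pi_lambda _ fun p => hM.measurable_fading _ _ _
  let D : Set Ω' := {z | ∀ k ∈ S, ENNReal.ofReal θ < SINR α W η X' h' n k z}
  have hD : MeasurableSet D := by
    have : D = ⋂ k ∈ S, {z | ENNReal.ofReal θ < SINR α W η X' h' n k z} := by
      ext z
      simp [D]
    rw [this]
    exact Finset.measurableSet_biInter _ fun k _ =>
      measurableSet_lt measurable_const (measurable_SINR hX' hh' α W η n k)
  change P {ω | (f ω, g ω) ∈ D} = _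
  rw [measure_mem_of_indepFun hf hg hM.indep_location_fading hD]
  refine lintegral_congr_ae ?_
  filter_upwards [hM.ae_ne_zero n] with ω hω
  set s := serving X n ω with hs
  have hR : 0 < ‖X n s ω‖ := norm_pos_iff.2 (hω s)
  have hset : {ω' | (f ω, g ω') ∈ D} = {ω' | ∀ k ∈ S,
      ENNReal.ofReal (θ * ‖X n s ω‖ ^ α * (η * W)) +
        ∑' p : N × ℕ, (if p = (n, s) then 0 else ENNReal.ofReal
          (θ * ‖X n s ω‖ ^ α * ‖X p.1 p.2 ω‖ ^ (-α) * h p.1 p.2 k ω')) <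
        ENNReal.ofReal (h n s k ω')} := by
    ext ω'
    exact forall₂_congr fun k _ => lt_SINR_iff hθ X' h' n k (f ω, g ω') hR
  rw [hset]
  exact measure_fading (H := fun p k ω' => h p.1 p.2 k ω')
    (fun p k => hM.measurable_fading _ _ _) (fun p k => hM.law_fading _ _ _)
    (hM.indep_fading.precomp (g := fun q : (N × ℕ) × N => (q.1.1, q.1.2, q.2))
      (Equiv.prodAssoc N ℕ N).injective) (n, s) _
    (c := fun p => θ * ‖X n s ω‖ ^ α * ‖X p.1 p.2 ω‖ ^ (-α)) (fun p => by positivity) S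

end Coverage

/-! ### The Euler integral of the hypergeometric function -/

section Hypergeometric

theorem integrableOn_rpow_sub_one {b : ℝ} (hb : 0 < b) :
    IntegrableOn (fun u : ℝ => u ^ (b - 1)) (Set.Ioc 0 1) :=
  (intervalIntegrable_iff_integrableOn_Ioc_of_le zero_le_one).1
    (intervalIntegral.intervalIntegrable_rpow' (by linarith))

/-- The real part of `1 - zu` is affine in `u`, hence at least the smaller of its values at `u = 0`
and `u = 1`. This bounds Euler's integrand on the half-plane `Re z < 1`. -/
theorem min_le_norm_one_sub_mul {z : ℂ} {u : ℝ} (hu : u ∈ Set.Ioc (0 : ℝ) 1) :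
    min 1 (1 - z.re) ≤ ‖1 - z * u‖ := by
  refine le_trans ?_ (Complex.re_le_norm _)
  simp only [Complex.sub_re, Complex.one_re, Complex.re_mul_ofReal]
  rcases le_total z.re 0 with h | h
  · exact (min_le_left _ _).trans (by nlinarith [hu.1])
  · exact (min_le_right _ _).trans (by nlinarith [hu.2])

theorem differentiableAt_eulerIntegral (l : ℕ) {b : ℝ} (hb : 0 < b) {z₀ : ℂ} (hz : z₀.re < 1) :
    DifferentiableAt ℂ (fun z : ℂ => ∫ u in Set.Ioc (0 : ℝ) 1,
      ((u ^ (b - 1) : ℝ) : ℂ) * ((1 - z * u) ^ l)⁻¹) z₀ := by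
  set d : ℝ := min 1 ((1 - z₀.re) / 2) with hd
  have hd0 : 0 < d := lt_min one_pos (by linarith)
  have hball {z : ℂ} (hzb : z ∈ Metric.ball z₀ ((1 - z₀.re) / 2)) {u : ℝ}
      (hu : u ∈ Set.Ioc (0 : ℝ) 1) : d ≤ ‖1 - z * u‖ := by
    refine le_trans (min_le_min_left 1 ?_) (min_le_norm_one_sub_mul hu)
    have h1 := (Complex.abs_re_le_norm (z - z₀)).trans_lt (mem_ball_iff_norm.1 hzb)
    have h2 := (abs_lt.1 h1).2
    rw [Complex.sub_re] at h2
    linarith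
  have hε : 0 < (1 - z₀.re) / 2 := by linarith
  have hint := integrableOn_rpow_sub_one hb
  have hm (z : ℂ) (k : ℕ) : AEStronglyMeasurable (fun u : ℝ =>
      ((u ^ (b - 1) : ℝ) : ℂ) * ((1 - z * u) ^ k)⁻¹) (volume.restrict (Set.Ioc 0 1)) := by
    apply Measurable.aestronglyMeasurable
    fun_prop
  have hbound {z : ℂ} (hzb : z ∈ Metric.ball z₀ ((1 - z₀.re) / 2)) {u : ℝ}
      (hu : u ∈ Set.Ioc (0 : ℝ) 1) (k : ℕ) :
      ‖((u ^ (b - 1) : ℝ) : ℂ) * ((1 - z * u) ^ k)⁻¹‖ ≤ u ^ (b - 1) * (d ^ k)⁻¹ := by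
    rw [norm_mul, Complex.norm_real, Real.norm_of_nonneg (Real.rpow_nonneg hu.1.le _), norm_inv,
      norm_pow]
    have := hball hzb hu
    have := Real.rpow_nonneg hu.1.le (b - 1)
    gcongr
  refine (hasDerivAt_integral_of_dominated_loc_of_deriv_le
    (F' := fun z u => ((u ^ (b - 1) : ℝ) : ℂ) * (l * u * ((1 - z * u) ^ (l + 1))⁻¹))
    (bound := fun u => l * (u ^ (b - 1) * (d ^ (l + 1))⁻¹))
    (Metric.ball_mem_nhds z₀ hε) (Eventually.of_forall fun z => hm z l) ?_ ?_ ?_ ?_ ?_).2.differentiableAt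
  · refine Integrable.mono' (hint.mul_const (d ^ l)⁻¹) (hm z₀ l) ?_
    filter_upwards [ae_restrict_mem measurableSet_Ioc] with u hu
    exact hbound (Metric.mem_ball_self hε) hu l
  · apply Measurable.aestronglyMeasurable
    fun_prop
  · filter_upwards [ae_restrict_mem measurableSet_Ioc] with u hu z hzb
    have h := hbound hzb hu (l + 1)
    calc ‖((u ^ (b - 1) : ℝ) : ℂ) * (l * u * ((1 - z * u) ^ (l + 1))⁻¹)‖
        = l * u * ‖((u ^ (b - 1) : ℝ) : ℂ) * ((1 - z * u) ^ (l + 1))⁻¹‖ := by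
          simp only [norm_mul, Complex.norm_natCast, Complex.norm_real, Real.norm_of_nonneg hu.1.le]
          ring
      _ ≤ l * 1 * (u ^ (b - 1) * (d ^ (l + 1))⁻¹) := by
          have := hu.2
          have := hu.1.le
          gcongr
      _ = _ := by ring
  · exact (hint.mul_const _).const_mul _
  · filter_upwards [ae_restrict_mem measurableSet_Ioc] with u hu z hzb
    have h0 : (1 - z * u : ℂ) ≠ 0 := norm_pos_iff.1 (hd0.trans_le (hball hzb hu))
    refine HasDerivAt.const_mul _ ?_
    have h1 : HasDerivAt (fun z : ℂ => 1 - z * u) (-u) z := by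
      simpa using ((hasDerivAt_id z).mul_const (u : ℂ)).const_sub 1
    have h2 := (h1.pow l).inv (pow_ne_zero l h0)
    refine h2.congr_deriv ?_
    cases l with
    | zero => simp
    | succ l =>
      simp only [Nat.add_sub_cancel, Pi.pow_apply]
      field_simp
      ring

/-- The complex integral is holomorphic on the half-plane `Re z < 1`, hence analytic; on the real
axis it equals the real integral. -/
theorem analyticOnNhd_eulerIntegral (l : ℕ) {b : ℝ} (hb : 0 < b) :
    AnalyticOnNhd ℝ (fun z : ℝ => ∫ u in Set.Ioc (0 : ℝ) 1, u ^ (b - 1) * ((1 - z * u) ^ l)⁻¹)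
      (Set.Iio 1) := by
  intro x hx
  have hopen : IsOpen {z : ℂ | z.re < 1} := isOpen_lt Complex.continuous_re continuous_const
  have hd : DifferentiableOn ℂ (fun z : ℂ => ∫ u in Set.Ioc (0 : ℝ) 1,
      ((u ^ (b - 1) : ℝ) : ℂ) * ((1 - z * u) ^ l)⁻¹) {z : ℂ | z.re < 1} :=
    fun z hz => (differentiableAt_eulerIntegral l hb hz).differentiableWithinAt
  have h := (hd.analyticOnNhd hopen (x : ℂ) (by simpa using hx)).re_ofReal
  convert h using 2 with y
  have : ∀ u : ℝ, ((u ^ (b - 1) : ℝ) : ℂ) * ((1 - (y : ℂ) * u) ^ l)⁻¹ =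
      ((u ^ (b - 1) * ((1 - y * u) ^ l)⁻¹ : ℝ) : ℂ) := fun u => by push_cast; ring
  simp only [this]
  rw [integral_complex_ofReal, Complex.ofReal_re]

theorem ascPochhammer_eval_mul_add (b : ℝ) (m : ℕ) :
    (ascPochhammer ℝ m).eval b * (b + m) = b * (ascPochhammer ℝ m).eval (b + 1) := by
  induction m with
  | zero => simp
  | succ m ih =>
    rw [ascPochhammer_succ_eval, ascPochhammer_succ_eval, ih]
    push_cast
    ring

/-- `(b)_m / (b+1)_m` telescopes to `b/(b+m)`, and `(l+1)_m / m!` is a negative binomial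
coefficient. -/
theorem hypergeometricCoefficient_eq (l m : ℕ) {b : ℝ} (hb : 0 < b) :
    ((m.factorial : ℝ)⁻¹) * (ascPochhammer ℝ m).eval ((l + 1 : ℕ) : ℝ) *
      (ascPochhammer ℝ m).eval b * ((ascPochhammer ℝ m).eval (b + 1))⁻¹ =
      b * (((m + l).choose l : ℝ) * (b + m)⁻¹) := by
  have h1 : (ascPochhammer ℝ m).eval ((l + 1 : ℕ) : ℝ) = m.factorial * ((m + l).choose l : ℝ) := by
    rw [← ascPochhammer_eval_cast, ascPochhammer_nat_eq_ascFactorial,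
      Nat.ascFactorial_eq_factorial_mul_choose, Nat.add_comm l m, Nat.choose_symm_add]
    push_cast
    ring
  have h2 : (ascPochhammer ℝ m).eval (b + 1) ≠ 0 :=
    (ascPochhammer_pos m (b + 1) (by linarith)).ne'
  have h3 : b + m ≠ 0 := by positivity
  have h4 : (m.factorial : ℝ) ≠ 0 := by positivity
  rw [h1]
  field_simp
  linear_combination ((m + l).choose l : ℝ) * ascPochhammer_eval_mul_add b m

/-- Euler's integral continues the hypergeometric series. -/
theorem isHypergeometricContinuation_eulerIntegral (l : ℕ) {b : ℝ} (hb : 0 < b) :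
    IsHypergeometricContinuation ((l + 1 : ℕ) : ℝ) b (b + 1) fun z =>
      b * ∫ u in Set.Ioc (0 : ℝ) 1, u ^ (b - 1) * ((1 - z * u) ^ (l + 1))⁻¹ := by
  refine ⟨fun x hx => analyticAt_const.mul (analyticOnNhd_eulerIntegral (l + 1) hb x hx),
    fun x hx => ?_⟩
  have hx1 : |x| < 1 := abs_lt.2 hx
  -- The terms of the negative binomial series of `(1 - xu)^(-(l+1))` times `u^(b-1)`, to be
  -- integrated termwise.
  set f : ℕ → ℝ → ℝ := fun m u => ((m + l).choose l : ℝ) * x ^ m * u ^ (b + m - 1) with hf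
  have hpos (m : ℕ) : 0 < b + m := by positivity
  have hfint (m : ℕ) : IntegrableOn (f m) (Set.Ioc 0 1) :=
    (integrableOn_rpow_sub_one (hpos m)).const_mul _
  have hrint (m : ℕ) : ∫ u in Set.Ioc (0 : ℝ) 1, u ^ (b + m - 1) = (b + m)⁻¹ := by
    rw [← intervalIntegral.integral_of_le zero_le_one, integral_rpow (Or.inl (by linarith [hpos m])),
      sub_add_cancel, Real.one_rpow, Real.zero_rpow (hpos m).ne', sub_zero, one_div]
  have hI (m : ℕ) : ∫ u in Set.Ioc (0 : ℝ) 1, f m u = ((m + l).choose l : ℝ) * x ^ m * (b + m)⁻¹ := by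
    simp only [hf]
    rw [integral_const_mul, hrint]
  have hN (m : ℕ) : ∫ u in Set.Ioc (0 : ℝ) 1, ‖f m u‖ =
      ((m + l).choose l : ℝ) * |x| ^ m * (b + m)⁻¹ := by
    rw [← hrint m, ← integral_const_mul]
    refine setIntegral_congr_fun measurableSet_Ioc fun u hu => ?_
    simp only [hf, norm_mul, norm_pow, Real.norm_eq_abs, Nat.abs_cast,
      abs_of_nonneg (Real.rpow_nonneg hu.1.le _)]
  have hsum : Summable fun m => ∫ u in Set.Ioc (0 : ℝ) 1, ‖f m u‖ := by
    simp only [hN]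
    refine Summable.of_nonneg_of_le (fun m => ?_) (fun m => ?_)
      ((hasSum_choose_mul_geometric_of_norm_lt_one l (r := |x|) (by simpa using hx1)).summable.mul_right
        b⁻¹)
    · have := hpos m
      positivity
    · gcongr
      simp
  have hs := hasSum_integral_of_summable_integral_norm hfint hsum
  have hlim : ∫ u in Set.Ioc (0 : ℝ) 1, ∑' m, f m u =
      ∫ u in Set.Ioc (0 : ℝ) 1, u ^ (b - 1) * ((1 - x * u) ^ (l + 1))⁻¹ := by
    refine setIntegral_congr_fun measurableSet_Ioc fun u hu => ?_
    have hxu : ‖x * u‖ < 1 := by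
      rw [norm_mul, Real.norm_eq_abs, Real.norm_of_nonneg hu.1.le]
      nlinarith [hu.2, abs_nonneg x, hu.1]
    have h := (hasSum_choose_mul_geometric_of_norm_lt_one l hxu).mul_left (u ^ (b - 1))
    rw [one_div] at h
    rw [← h.tsum_eq]
    refine tsum_congr fun m => ?_
    simp only [hf]
    rw [show b + m - 1 = (b - 1) + m by ring, Real.rpow_add hu.1, Real.rpow_natCast, mul_pow]
    ring
  rw [hlim] at hs
  simp only [hI] at hs
  change b * _ = _
  rw [← (hs.mul_left b).tsum_eq, ordinaryHypergeometric_eq_tsum]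
  refine tsum_congr fun m => ?_
  rw [smul_eq_mul, hypergeometricCoefficient_eq l m hb]
  ring

theorem zeta_eq {θ α : ℝ} (hθ : 0 < θ) (hα : 2 < α) {l : ℕ} (hl : 1 ≤ l) :
    zeta θ α l = 2 / α * ∫ v in Set.Ioc (0 : ℝ) 1,
      θ ^ l * (v ^ (l - 2 / α - 1) * ((1 + θ * v) ^ l)⁻¹) := by
  obtain ⟨l, rfl⟩ := Nat.exists_eq_add_of_le' hl
  have hα0 : 0 < α := by linarith
  have hb : 0 < ((l + 1 : ℕ) : ℝ) - 2 / α := by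
    have : 2 / α < 1 := (div_lt_one hα0).2 hα
    push_cast
    have : (0 : ℝ) ≤ l := Nat.cast_nonneg l
    linarith
  have hd : ((l + 1 : ℕ) : ℝ) * α - 2 = α * (((l + 1 : ℕ) : ℝ) - 2 / α) := by
    field_simp
  rw [zeta, gaussHypergeometric_eq (isHypergeometricContinuation_eulerIntegral l hb)
    (by linarith : -θ < 1), hd, integral_const_mul]
  simp only [neg_mul, sub_neg_eq_add]
  generalize (((l + 1 : ℕ) : ℝ) - 2 / α) = b at hb
  field_simp

end Hypergeometric

/-! ### The Beta integral -/

section Beta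

theorem lintegral_rpow_mul_exp_neg_mul {a r : ℝ} (ha : 0 < a) (hr : 0 < r) :
    ∫⁻ s in Set.Ioi (0 : ℝ), ENNReal.ofReal (s ^ (a - 1) * Real.exp (-(r * s))) =
      ENNReal.ofReal ((1 / r) ^ a * Real.Gamma a) := by
  rw [← Real.integral_rpow_mul_exp_neg_mul_Ioi ha hr, ofReal_integral_eq_lintegral_ofReal]
  -- A non-integrable function would have Bochner integral `0`, but the value is a positive multiple
  -- of a Gamma value.
  · by_contra h
    have h0 := Real.integral_rpow_mul_exp_neg_mul_Ioi ha hr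
    rw [integral_undef h] at h0
    have : 0 < (1 / r) ^ a * Real.Gamma a :=
      mul_pos (Real.rpow_pos_of_pos (by positivity) a) (Real.Gamma_pos_of_pos ha)
    exact this.ne h0
  · filter_upwards [ae_restrict_mem measurableSet_Ioi] with s hs
    have := Real.rpow_nonneg (le_of_lt hs) (a - 1)
    positivity

/-- Write `(1 + θv)^(-(a+b))` as a Gamma integral in `s` and exchange the order by Tonelli:
integrating over `v` first leaves `Γ(a) Γ(b)`. -/
theorem lintegral_beta {a b θ : ℝ} (ha : 0 < a) (hb : 0 < b) (hθ : 0 < θ) :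
    ∫⁻ v in Set.Ioi (0 : ℝ), ENNReal.ofReal (v ^ (b - 1) * (1 / (1 + θ * v)) ^ (a + b)) =
      ENNReal.ofReal (θ ^ (-b) * ProbabilityTheory.beta a b) := by
  have hab : 0 < a + b := by positivity
  have hG := Real.Gamma_pos_of_pos hab
  have hGa := Real.Gamma_pos_of_pos ha
  have hGb := Real.Gamma_pos_of_pos hb
  have h1 : ∫⁻ v in Set.Ioi (0 : ℝ), ∫⁻ s in Set.Ioi (0 : ℝ), ENNReal.ofReal
      (v ^ (b - 1) * (s ^ (a + b - 1) * Real.exp (-((1 + θ * v) * s)))) =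
      ENNReal.ofReal (Real.Gamma (a + b)) * ∫⁻ v in Set.Ioi (0 : ℝ),
        ENNReal.ofReal (v ^ (b - 1) * (1 / (1 + θ * v)) ^ (a + b)) := by
    rw [← lintegral_const_mul' _ _ ENNReal.ofReal_ne_top]
    refine setLIntegral_congr_fun measurableSet_Ioi fun v (hv : 0 < v) => ?_
    have hv1 : 0 ≤ v ^ (b - 1) := Real.rpow_nonneg hv.le _
    simp only [ENNReal.ofReal_mul hv1]
    rw [lintegral_const_mul' _ _ ENNReal.ofReal_ne_top,
      lintegral_rpow_mul_exp_neg_mul hab (by positivity : 0 < 1 + θ * v),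
      ENNReal.ofReal_mul (Real.rpow_nonneg (by positivity) _)]
    ring
  have h2 : ∫⁻ s in Set.Ioi (0 : ℝ), ∫⁻ v in Set.Ioi (0 : ℝ), ENNReal.ofReal
      (v ^ (b - 1) * (s ^ (a + b - 1) * Real.exp (-((1 + θ * v) * s)))) =
      ENNReal.ofReal (θ ^ (-b) * (Real.Gamma a * Real.Gamma b)) := by
    have h3 : ∀ s ∈ Set.Ioi (0 : ℝ), ∫⁻ v in Set.Ioi (0 : ℝ), ENNReal.ofReal
        (v ^ (b - 1) * (s ^ (a + b - 1) * Real.exp (-((1 + θ * v) * s)))) =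
        ENNReal.ofReal (θ ^ (-b) * Real.Gamma b) *
          ENNReal.ofReal (s ^ (a - 1) * Real.exp (-(1 * s))) := by
      intro s hs
      have hs' : (0 : ℝ) < s := hs
      have hs1 : 0 ≤ s ^ (a + b - 1) * Real.exp (-s) := by positivity
      have e (v : ℝ) : v ^ (b - 1) * (s ^ (a + b - 1) * Real.exp (-((1 + θ * v) * s))) =
          s ^ (a + b - 1) * Real.exp (-s) * (v ^ (b - 1) * Real.exp (-(θ * s * v))) := by
        rw [show -((1 + θ * v) * s) = -s + -(θ * s * v) by ring, Real.exp_add]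
        ring
      simp only [e, ENNReal.ofReal_mul hs1]
      rw [lintegral_const_mul' _ _ ENNReal.ofReal_ne_top,
        lintegral_rpow_mul_exp_neg_mul hb (by positivity : 0 < θ * s), ← ENNReal.ofReal_mul hs1,
        ← ENNReal.ofReal_mul (by positivity)]
      congr 1
      rw [one_div, Real.inv_rpow (by positivity), Real.mul_rpow hθ.le hs'.le, mul_inv,
        ← Real.rpow_neg hθ.le, ← Real.rpow_neg hs'.le, show a + b - 1 = a - 1 + b by ring,
        Real.rpow_add hs', Real.rpow_neg hs'.le b, one_mul]
      have : s ^ b ≠ 0 := (Real.rpow_pos_of_pos hs' b).ne'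
      field_simp
    rw [setLIntegral_congr_fun measurableSet_Ioi h3, lintegral_const_mul' _ _ ENNReal.ofReal_ne_top,
      lintegral_rpow_mul_exp_neg_mul ha one_pos, ← ENNReal.ofReal_mul (by positivity)]
    congr 1
    simp only [div_one, Real.one_rpow]
    ring
  rw [lintegral_lintegral_swap (by
    apply Measurable.aemeasurable
    unfold Function.uncurry
    fun_prop), h2] at h1
  have hG' : ENNReal.ofReal (Real.Gamma (a + b)) ≠ 0 := by simpa using hG
  rw [← ENNReal.mul_right_inj hG' ENNReal.ofReal_ne_top, ← h1, ← ENNReal.ofReal_mul hG.le]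
  congr 1
  rw [ProbabilityTheory.beta]
  field_simp

/-- The Beta integral with `a = 2/α` and `b = l - 2/α`, for which `a + b = l` is an integer power.
-/
theorem integrableOn_and_zetaZero_eq {θ α : ℝ} (hθ : 0 < θ) (hα : 2 < α) {l : ℕ} (hl : 1 ≤ l) :
    IntegrableOn (fun v : ℝ => θ ^ l * (v ^ (l - 2 / α - 1) * ((1 + θ * v) ^ l)⁻¹)) (Set.Ioi 0) ∧
    zetaZero θ α l = 2 / α * ∫ v in Set.Ioi (0 : ℝ),
      θ ^ l * (v ^ (l - 2 / α - 1) * ((1 + θ * v) ^ l)⁻¹) := by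
  have hα0 : 0 < α := by linarith
  have hl' : (1 : ℝ) ≤ l := by exact_mod_cast hl
  have hb : 0 < (l : ℝ) - 2 / α := by
    have : 2 / α < 1 := (div_lt_one hα0).2 hα
    linarith
  have ha : 0 < 2 / α := by positivity
  have h := lintegral_beta ha hb hθ
  have e : Set.EqOn (fun v : ℝ => v ^ ((l : ℝ) - 2 / α - 1) *
      (1 / (1 + θ * v)) ^ (2 / α + (l - 2 / α))) (fun v : ℝ => v ^ (l - 2 / α - 1) *
        ((1 + θ * v) ^ l)⁻¹) (Set.Ioi 0) := fun v hv => by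
    simp only [add_sub_cancel, Real.rpow_natCast, one_div, inv_pow]
  rw [setLIntegral_congr_fun measurableSet_Ioi fun v hv => congrArg ENNReal.ofReal (e hv)] at h
  have hnn : 0 ≤ᵐ[volume.restrict (Set.Ioi (0 : ℝ))] fun v : ℝ => v ^ (l - 2 / α - 1) *
      ((1 + θ * v) ^ l)⁻¹ := by
    filter_upwards [ae_restrict_mem measurableSet_Ioi] with v hv
    have hv' : (0 : ℝ) < v := hv
    have := Real.rpow_nonneg hv'.le (l - 2 / α - 1)
    positivity
  have hmeas : AEStronglyMeasurable (fun v : ℝ => v ^ (l - 2 / α - 1) * ((1 + θ * v) ^ l)⁻¹)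
      (volume.restrict (Set.Ioi (0 : ℝ))) := by
    apply Measurable.aestronglyMeasurable
    fun_prop
  have hB := ProbabilityTheory.beta_pos ha hb
  refine ⟨Integrable.const_mul ⟨hmeas, ?_⟩ _, ?_⟩
  · rw [hasFiniteIntegral_iff_ofReal hnn, h]
    exact ENNReal.ofReal_lt_top
  · rw [integral_const_mul, integral_eq_lintegral_of_nonneg_ae hnn hmeas, h,
      ENNReal.toReal_ofReal (by positivity), zetaZero, neg_sub, Real.rpow_sub hθ,
      Real.rpow_natCast]
    field_simp

end Beta

/-! ### Planar integrals -/

section Planar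

/-- The coefficient of the transmitters of the own operator in the `m`-th integrand. -/
def zetaSum (θ α : ℝ) (m : ℕ) : ℝ :=
  ∑ l ∈ Finset.Icc 1 m, (m.choose l : ℝ) * (-1) ^ (l + 1) * zeta θ α l

/-- The coefficient of the transmitters of the other operators in the `m`-th integrand. -/
def zetaZeroSum (θ α : ℝ) (m : ℕ) : ℝ :=
  ∑ l ∈ Finset.Icc 1 m, (m.choose l : ℝ) * (-1) ^ (l + 1) * zetaZero θ α l

/-- Binomial theorem for `1/(1 + v) = 1 - v/(1 + v)`; the term `l = 0` cancels the leading `1`. -/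
theorem one_sub_inv_pow (m : ℕ) {v : ℝ} (hv : 0 ≤ v) :
    1 - ((1 + v) ^ m)⁻¹ =
      ∑ l ∈ Finset.Icc 1 m, (m.choose l : ℝ) * (-1) ^ (l + 1) * (v ^ l * ((1 + v) ^ l)⁻¹) := by
  have h1 : (1 + v) ≠ 0 := by positivity
  have h : ((1 + v) ^ m)⁻¹ = (-(v / (1 + v)) + 1) ^ m := by
    rw [← inv_pow]
    congr 1
    field_simp
    ring
  rw [h, add_pow, Finset.range_eq_Ico, Finset.sum_eq_sum_Ico_succ_bot (Nat.succ_pos m)]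
  simp only [one_pow, mul_one, pow_zero, Nat.choose_zero_right, Nat.cast_one, zero_add]
  rw [sub_add_cancel_left, ← Finset.sum_neg_distrib, Nat.succ_eq_add_one,
    Finset.Ico_add_one_right_eq_Icc]
  refine Finset.sum_congr rfl fun l _ => ?_
  rw [neg_pow, div_pow, pow_succ]
  ring

variable {θ α : ℝ}

theorem rpow_mul_one_sub_inv_pow (hθ : 0 < θ) (m : ℕ) {v : ℝ} (hv : 0 < v) :
    v ^ (-(2 / α) - 1) * (1 - ((1 + θ * v) ^ m)⁻¹) =
      ∑ l ∈ Finset.Icc 1 m, (m.choose l : ℝ) * (-1) ^ (l + 1) *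
        (θ ^ l * (v ^ (l - 2 / α - 1) * ((1 + θ * v) ^ l)⁻¹)) := by
  rw [one_sub_inv_pow m (by positivity), Finset.mul_sum]
  refine Finset.sum_congr rfl fun l _ => ?_
  rw [show (l : ℝ) - 2 / α - 1 = -(2 / α) - 1 + l by ring, Real.rpow_add hv, Real.rpow_natCast,
    mul_pow]
  ring

theorem integrableOn_and_zetaZeroSum_eq (hθ : 0 < θ) (hα : 2 < α) (m : ℕ) :
    IntegrableOn (fun v : ℝ => v ^ (-(2 / α) - 1) * (1 - ((1 + θ * v) ^ m)⁻¹)) (Set.Ioi 0) ∧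
    2 / α * (∫ v in Set.Ioi (0 : ℝ), v ^ (-(2 / α) - 1) * (1 - ((1 + θ * v) ^ m)⁻¹)) =
      zetaZeroSum θ α m := by
  have hi : ∀ l ∈ Finset.Icc 1 m, IntegrableOn (fun v : ℝ => (m.choose l : ℝ) * (-1) ^ (l + 1) *
      (θ ^ l * (v ^ (l - 2 / α - 1) * ((1 + θ * v) ^ l)⁻¹))) (Set.Ioi 0) := fun l hl =>
    (integrableOn_and_zetaZero_eq hθ hα (Finset.mem_Icc.1 hl).1).1.const_mul _
  constructor
  · refine IntegrableOn.congr_fun (integrable_finsetSum _ hi)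
      (fun v hv => (rpow_mul_one_sub_inv_pow hθ m hv).symm) measurableSet_Ioi
  · rw [setIntegral_congr_fun measurableSet_Ioi fun v hv => rpow_mul_one_sub_inv_pow hθ m hv,
      integral_finsetSum _ hi, Finset.mul_sum]
    refine Finset.sum_congr rfl fun l hl => ?_
    rw [integral_const_mul, (integrableOn_and_zetaZero_eq hθ hα (Finset.mem_Icc.1 hl).1).2]
    ring

theorem zetaSum_eq (hθ : 0 < θ) (hα : 2 < α) (m : ℕ) :
    2 / α * (∫ v in Set.Ioc (0 : ℝ) 1, v ^ (-(2 / α) - 1) * (1 - ((1 + θ * v) ^ m)⁻¹)) =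
      zetaSum θ α m := by
  have hi : ∀ l ∈ Finset.Icc 1 m, IntegrableOn (fun v : ℝ => (m.choose l : ℝ) * (-1) ^ (l + 1) *
      (θ ^ l * (v ^ (l - 2 / α - 1) * ((1 + θ * v) ^ l)⁻¹))) (Set.Ioc 0 1) := fun l hl =>
    ((integrableOn_and_zetaZero_eq hθ hα (Finset.mem_Icc.1 hl).1).1.mono_set
      Set.Ioc_subset_Ioi_self).const_mul _
  rw [setIntegral_congr_fun measurableSet_Ioc fun v hv => rpow_mul_one_sub_inv_pow hθ m hv.1,
    integral_finsetSum _ hi, Finset.mul_sum]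
  refine Finset.sum_congr rfl fun l hl => ?_
  rw [integral_const_mul, zeta_eq hθ hα (Finset.mem_Icc.1 hl).1]
  ring

theorem one_sub_inv_pow_nonneg (m : ℕ) {v : ℝ} (hv : 0 ≤ v) : 0 ≤ 1 - ((1 + v) ^ m)⁻¹ :=
  sub_nonneg.2 (inv_le_one_of_one_le₀ (one_le_pow₀ (by linarith)))

/-- The sum alternates in sign, but it is the integral of a nonnegative function. -/
theorem zetaZeroSum_nonneg (hθ : 0 < θ) (hα : 2 < α) (m : ℕ) : 0 ≤ zetaZeroSum θ α m := by
  rw [← (integrableOn_and_zetaZeroSum_eq hθ hα m).2]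
  refine mul_nonneg (by positivity) (setIntegral_nonneg measurableSet_Ioi fun v hv => ?_)
  have hv' : (0 : ℝ) < v := hv
  exact mul_nonneg (by positivity) (one_sub_inv_pow_nonneg m (by positivity))

theorem zetaSum_nonneg (hθ : 0 < θ) (hα : 2 < α) (m : ℕ) : 0 ≤ zetaSum θ α m := by
  rw [← zetaSum_eq hθ hα m]
  refine mul_nonneg (by positivity) (setIntegral_nonneg measurableSet_Ioc fun v hv => ?_)
  have hv' : (0 : ℝ) < v := hv.1
  exact mul_nonneg (by positivity) (one_sub_inv_pow_nonneg m (by positivity))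

/-- Polar coordinates, scaling by `√t`, and `v = x^(-α)`, under which `x dx` becomes `α⁻¹ v^(-2/α-1)
dv` up to orientation. -/
theorem integrable_and_integral_radial (hα : 0 < α) {t : ℝ} (ht : 0 < t) {L : ℝ → ℝ}
    (hL : IntegrableOn (fun v : ℝ => v ^ (-(2 / α) - 1) * L v) (Set.Ioi 0)) :
    Integrable (fun y : Plane => L ((‖y‖ / √t) ^ (-α))) ∧
    ∫ y : Plane, L ((‖y‖ / √t) ^ (-α)) =
      Real.pi * t * (2 / α * ∫ v in Set.Ioi (0 : ℝ), v ^ (-(2 / α) - 1) * L v) := by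
  have hα' : -α ≠ 0 := neg_ne_zero.2 hα.ne'
  have hst : 0 < (√t)⁻¹ := by positivity
  have e1 : Set.EqOn (fun x : ℝ => (|(-α)| * x ^ (-α - 1)) •
      ((x ^ (-α)) ^ (-(2 / α) - 1) * L (x ^ (-α)))) (fun x => α * (x * L (x ^ (-α))))
      (Set.Ioi 0) := by
    intro x hx
    have hx' : (0 : ℝ) < x := hx
    simp only [smul_eq_mul, abs_neg, abs_of_pos hα]
    rw [← Real.rpow_mul hx'.le]
    have : x ^ (-α - 1) * x ^ (-α * (-(2 / α) - 1)) = x := by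
      rw [← Real.rpow_add hx', show -α - 1 + -α * (-(2 / α) - 1) = 1 by field_simp; ring,
        Real.rpow_one]
    linear_combination α * L (x ^ (-α)) * this
  have e2 (r : ℝ) : r ^ (Module.finrank ℝ Plane - 1) • L ((r / √t) ^ (-α)) =
      √t * ((√t)⁻¹ * r * L (((√t)⁻¹ * r) ^ (-α))) := by
    rw [finrank_euclideanSpace_fin, Nat.add_one_sub_one, pow_one, smul_eq_mul,
      div_eq_inv_mul r (√t)]
    field_simp
  have hi : IntegrableOn (fun x : ℝ => x * L (x ^ (-α))) (Set.Ioi 0) := by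
    have h := (integrableOn_Ioi_comp_rpow_iff _ hα').2 hL
    have h' := (h.congr_fun e1 measurableSet_Ioi).const_mul α⁻¹
    simp only [inv_mul_cancel_left₀ hα.ne'] at h'
    exact h'
  have hv : ∫ x in Set.Ioi (0 : ℝ), x * L (x ^ (-α)) =
      α⁻¹ * ∫ v in Set.Ioi (0 : ℝ), v ^ (-(2 / α) - 1) * L v := by
    rw [← integral_comp_rpow_Ioi (fun v => v ^ (-(2 / α) - 1) * L v) hα', setIntegral_congr_fun measurableSet_Ioi e1,
      integral_const_mul, inv_mul_cancel_left₀ hα.ne']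
  constructor
  · rw [integrable_fun_norm_addHaar volume (f := fun r => L ((r / √t) ^ (-α)))]
    simp only [e2]
    refine Integrable.const_mul ?_ _
    have h := (integrableOn_Ioi_comp_mul_left_iff (fun x : ℝ => x * L (x ^ (-α))) 0 hst).2
    rw [mul_zero] at h
    exact h hi
  · rw [integral_fun_norm_addHaar volume (fun r => L ((r / √t) ^ (-α)))]
    simp only [e2]
    rw [integral_const_mul, integral_comp_mul_left_Ioi (fun x : ℝ => x * L (x ^ (-α))) 0 hst,
      mul_zero, hv, finrank_euclideanSpace_fin, measureReal_def, EuclideanSpace.volume_ball_fin_two]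
    have hs : √t * √t = t := Real.mul_self_sqrt ht.le
    simp only [ENNReal.ofReal_one, one_pow, one_mul, smul_eq_mul, nsmul_eq_mul,
      inv_inv, Nat.cast_ofNat, ENNReal.toReal_ofReal Real.pi_pos.le]
    linear_combination 2 * Real.pi * α⁻¹ *
      (∫ v in Set.Ioi (0 : ℝ), v ^ (-(2 / α) - 1) * L v) * hs

/-- The attenuation exponent at `y` caused by the interference in `m` bands, when the serving
transmitter is at distance `√t`. -/
def attenuation (θ α : ℝ) (m : ℕ) (t : ℝ) (y : Plane) : ℝ≥0∞ :=
  ENNReal.ofReal (m * Real.log (1 + θ * t ^ (α / 2) * ‖y‖ ^ (-α)))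

theorem measurable_attenuation (θ α : ℝ) (m : ℕ) (t : ℝ) : Measurable (attenuation θ α m t) := by
  unfold attenuation
  fun_prop

theorem expNeg_mul_log (m : ℕ) {v : ℝ} (hv : 0 ≤ v) :
    expNeg (ENNReal.ofReal (m * Real.log (1 + v))) = ENNReal.ofReal ((1 + v) ^ m)⁻¹ := by
  have h1 : 0 < 1 + v := by linarith
  rw [expNeg_ofReal (mul_nonneg (Nat.cast_nonneg _) (Real.log_nonneg (by linarith))),
    Real.exp_neg, mul_comm, Real.exp_mul, Real.exp_log h1, Real.rpow_natCast]

theorem one_sub_expNeg_attenuation (hθ : 0 < θ) (m : ℕ) {t : ℝ} (ht : 0 < t) (y : Plane) :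
    1 - expNeg (attenuation θ α m t y) =
      ENNReal.ofReal (1 - ((1 + θ * (‖y‖ / √t) ^ (-α)) ^ m)⁻¹) := by
  have h : θ * t ^ (α / 2) * ‖y‖ ^ (-α) = θ * (‖y‖ / √t) ^ (-α) := by
    rw [Real.div_rpow (norm_nonneg _) (Real.sqrt_nonneg _), Real.sqrt_eq_rpow,
      ← Real.rpow_mul ht.le, show 1 / 2 * -α = -(α / 2) by ring, Real.rpow_neg ht.le, div_inv_eq_mul]
    ring
  rw [attenuation, h, expNeg_mul_log m (by positivity), ← ENNReal.ofReal_one,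
    ← ENNReal.ofReal_sub _ (by positivity)]

theorem lintegral_one_sub_expNeg_attenuation (hθ : 0 < θ) (hα : 2 < α) (m : ℕ) {t : ℝ}
    (ht : 0 < t) :
    ∫⁻ y, 1 - expNeg (attenuation θ α m t y) =
      ENNReal.ofReal (Real.pi * t * zetaZeroSum θ α m) := by
  have h0 := integrableOn_and_zetaZeroSum_eq hθ hα m
  have h := integrable_and_integral_radial (by linarith) ht
    (L := fun v => 1 - ((1 + θ * v) ^ m)⁻¹) h0.1
  simp only [one_sub_expNeg_attenuation hθ m ht]
  rw [← h0.2, ← h.2, ofReal_integral_eq_lintegral_ofReal h.1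
    (ae_of_all _ fun y => one_sub_inv_pow_nonneg m (by positivity))]

/-- The exterior of the disc corresponds to `v ≤ 1`, so the radial formula is applied to the
integrand cut off at `1`. -/
theorem setLIntegral_one_sub_expNeg_attenuation (hθ : 0 < θ) (hα : 2 < α) (m : ℕ) {t : ℝ}
    (ht : 0 < t) :
    ∫⁻ y in {y : Plane | t ≤ ‖y‖ ^ 2}, 1 - expNeg (attenuation θ α m t y) =
      ENNReal.ofReal (Real.pi * t * zetaSum θ α m) := by
  have hα0 : 0 < α := by linarith
  have h0 := (integrableOn_and_zetaZeroSum_eq hθ hα m).1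
  set L : ℝ → ℝ := fun v => 1 - ((1 + θ * v) ^ m)⁻¹ with hL
  have e (v : ℝ) : v ^ (-(2 / α) - 1) * (Set.Iic 1).indicator L v =
      (Set.Iic 1).indicator (fun v => v ^ (-(2 / α) - 1) * L v) v := by
    by_cases hv : v ∈ Set.Iic (1 : ℝ) <;> simp [hv]
  have hi : IntegrableOn (fun v : ℝ => v ^ (-(2 / α) - 1) * (Set.Iic 1).indicator L v)
      (Set.Ioi 0) := by
    simp only [e]
    exact h0.indicator measurableSet_Iic
  have h := integrable_and_integral_radial hα0 ht hi
  have hv : ∫ v in Set.Ioi (0 : ℝ), v ^ (-(2 / α) - 1) * (Set.Iic 1).indicator L v =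
      ∫ v in Set.Ioc (0 : ℝ) 1, v ^ (-(2 / α) - 1) * L v := by
    simp only [e]
    rw [setIntegral_indicator measurableSet_Iic, Set.Ioi_inter_Iic]
  rw [hv, zetaSum_eq hθ hα m] at h
  have hmeas : MeasurableSet {y : Plane | t ≤ ‖y‖ ^ 2} :=
    measurableSet_le measurable_const (measurable_norm.pow_const 2)
  have hnn : ∀ y : Plane, 0 ≤ (Set.Iic 1).indicator L ((‖y‖ / √t) ^ (-α)) := fun y =>
    Set.indicator_apply_nonneg fun _ => one_sub_inv_pow_nonneg m (by positivity)
  rw [← h.2, ofReal_integral_eq_lintegral_ofReal h.1 (ae_of_all _ hnn), ← lintegral_indicator hmeas]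
  refine lintegral_congr_ae ?_
  filter_upwards [Measure.ae_ne volume (0 : Plane)] with y hy
  have hy0 : 0 < ‖y‖ := norm_pos_iff.2 hy
  have hst : 0 < √t := Real.sqrt_pos.2 ht
  have hiff : t ≤ ‖y‖ ^ 2 ↔ (‖y‖ / √t) ^ (-α) ≤ 1 := by
    have h1 : 1 ≤ (‖y‖ / √t) ^ α ↔ 1 ≤ ‖y‖ / √t := by
      simpa using Real.rpow_le_rpow_iff zero_le_one (div_nonneg hy0.le hst.le) hα0
    rw [Real.rpow_neg (by positivity), inv_le_one₀ (by positivity), h1, one_le_div hst,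
      Real.sqrt_le_left hy0.le]
  by_cases hyt : t ≤ ‖y‖ ^ 2
  · rw [Set.indicator_of_mem (show y ∈ {y : Plane | t ≤ ‖y‖ ^ 2} from hyt),
      Set.indicator_of_mem (show _ ∈ Set.Iic (1 : ℝ) from hiff.1 hyt),
      one_sub_expNeg_attenuation hθ m ht]
  · rw [Set.indicator_of_notMem (show y ∉ {y : Plane | t ≤ ‖y‖ ^ 2} from hyt),
      Set.indicator_of_notMem (show _ ∉ Set.Iic (1 : ℝ) from fun h => hyt (hiff.2 h)),
      ENNReal.ofReal_zero]

theorem volume_norm_sq_lt {t : ℝ} (ht : 0 ≤ t) :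
    volume {y : Plane | ‖y‖ ^ 2 < t} = ENNReal.ofReal (Real.pi * t) := by
  have : {y : Plane | ‖y‖ ^ 2 < t} = Metric.ball 0 √t := by
    ext y
    simp [Real.lt_sqrt (norm_nonneg y)]
  rw [this, EuclideanSpace.volume_ball_fin_two, ← ENNReal.ofReal_pow (Real.sqrt_nonneg t),
    Real.sq_sqrt ht, mul_comm Real.pi, ENNReal.ofReal_mul ht]

end Planar

/-! ### Increments of the coverage probability in the distance of the serving transmitter -/

section Increments

variable {Ω N : Type*} [DecidableEq N]

/-- The exponent in the Laplace functional that excludes transmitters of operator `n` at squared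
distance less than `a`, weighs those at squared distance in `[a, b)` by `κ`, and attenuates all
others as if the serving transmitter were at distance `√τ`. -/
def annulusExponent (θ α : ℝ) (m : ℕ) (n : N) (a b : ℝ) (κ : ℝ≥0∞) (τ : ℝ) (j : N) (y : Plane) :
    ℝ≥0∞ :=
  if j = n then
    if ‖y‖ ^ 2 < a then ∞ else if ‖y‖ ^ 2 < b then κ else attenuation θ α m τ y
  else attenuation θ α m τ y

theorem measurable_annulusExponent (θ α : ℝ) (m : ℕ) (n : N) (a b : ℝ) (κ : ℝ≥0∞) (τ : ℝ)
    (j : N) : Measurable (annulusExponent θ α m n a b κ τ j) := by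
  unfold annulusExponent
  have h (c : ℝ) : MeasurableSet {y : Plane | ‖y‖ ^ 2 < c} :=
    measurableSet_lt (measurable_norm.pow_const 2) measurable_const
  split_ifs
  · exact Measurable.ite (h a) measurable_const
      (Measurable.ite (h b) measurable_const (measurable_attenuation θ α m τ))
  · exact measurable_attenuation θ α m τ

variable {θ α : ℝ}

theorem attenuation_mono (hθ : 0 < θ) (hα : 0 < α) (m : ℕ) {t t' : ℝ} (ht : 0 ≤ t) (h : t ≤ t')
    (y : Plane) : attenuation θ α m t y ≤ attenuation θ α m t' y := by
  have h1 : t ^ (α / 2) ≤ t' ^ (α / 2) := Real.rpow_le_rpow ht h (by positivity)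
  have h2 : 0 ≤ t ^ (α / 2) := Real.rpow_nonneg ht _
  refine ENNReal.ofReal_le_ofReal (mul_le_mul_of_nonneg_left (Real.log_le_log (by positivity) ?_)
    (Nat.cast_nonneg m))
  gcongr

/-- A transmitter no closer than the serving one is weaker by path loss. The bound is the weight `κ`
used for the annulus in the lower estimate. -/
theorem attenuation_le (hθ : 0 < θ) (hα : 0 < α) (m : ℕ) {t : ℝ} (ht : 0 < t) {y : Plane}
    (hy : t ≤ ‖y‖ ^ 2) : attenuation θ α m t y ≤ ENNReal.ofReal (m * Real.log (1 + θ)) := by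
  have hy0 : 0 < ‖y‖ := by
    by_contra h
    have : ‖y‖ = 0 := le_antisymm (not_lt.1 h) (norm_nonneg y)
    rw [this] at hy
    norm_num at hy
    linarith
  have h1 : t ^ (α / 2) ≤ ‖y‖ ^ α := by
    calc t ^ (α / 2) ≤ (‖y‖ ^ 2) ^ (α / 2) := Real.rpow_le_rpow ht.le hy (by positivity)
      _ = ‖y‖ ^ α := by
        rw [← Real.rpow_natCast, ← Real.rpow_mul hy0.le]
        congr 1
        push_cast
        ring
  have h2 : t ^ (α / 2) * ‖y‖ ^ (-α) ≤ 1 := by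
    rw [Real.rpow_neg hy0.le, ← div_eq_mul_inv]
    exact div_le_one_of_le₀ h1 (by positivity)
  refine ENNReal.ofReal_le_ofReal (mul_le_mul_of_nonneg_left (Real.log_le_log (by positivity) ?_)
    (Nat.cast_nonneg m))
  nlinarith

/-- The contribution of the noise to the conditional coverage probability, when the serving
transmitter is at distance `√t`. -/
def noiseExponent (α W η θ : ℝ) (m : ℕ) (t : ℝ) : ℝ≥0∞ :=
  ENNReal.ofReal (m * (θ * t ^ (α / 2) * (η * W)))

theorem noiseExponent_mono (hθ : 0 < θ) (hα : 0 < α) {W η : ℝ} (hn : 0 ≤ η * W) (m : ℕ)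
    {t t' : ℝ} (ht : 0 ≤ t) (h : t ≤ t') :
    noiseExponent α W η θ m t ≤ noiseExponent α W η θ m t' := by
  have h1 : t ^ (α / 2) ≤ t' ^ (α / 2) := Real.rpow_le_rpow ht h (by positivity)
  refine ENNReal.ofReal_le_ofReal ?_
  gcongr

theorem conditionalCoverage_eq (α W η θ : ℝ) (X : N → ℕ → Ω → Plane) (n : N) (m : ℕ) (ω : Ω) :
    conditionalCoverage α W η θ X n m ω =
      expNeg (noiseExponent α W η θ m (‖X n (serving X n ω) ω‖ ^ 2) +
        ∑' p : N × ℕ, if p = (n, serving X n ω) then 0 else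
          attenuation θ α m (‖X n (serving X n ω) ω‖ ^ 2) (X p.1 p.2 ω)) := by
  have h : (‖X n (serving X n ω) ω‖ ^ 2) ^ (α / 2) = ‖X n (serving X n ω) ω‖ ^ α := by
    rw [← Real.rpow_natCast, ← Real.rpow_mul (norm_nonneg _)]
    congr 1
    push_cast
    ring
  simp only [noiseExponent, attenuation, h, conditionalCoverage]

section Pointwise

variable {X : N → ℕ → Ω → Plane} {n : N} {ω : Ω} {a b : ℝ}

theorem tsum_annulusExponent_eq_top (m : ℕ) {κ : ℝ≥0∞} {τ : ℝ}
    (h : ‖X n (serving X n ω) ω‖ ^ 2 < a ∨ κ = ∞ ∧ ‖X n (serving X n ω) ω‖ ^ 2 < b) :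
    ∑' p : N × ℕ, annulusExponent θ α m n a b κ τ p.1 (X p.1 p.2 ω) = ∞ := by
  refine ENNReal.tsum_eq_top_of_eq_top ⟨(n, serving X n ω), ?_⟩
  rcases h with h | ⟨h, h'⟩
  · simp [annulusExponent, h]
  · simp [annulusExponent, h, h']

theorem tsum_annulusExponent_congr (hω : ∀ i, ‖X n (serving X n ω) ω‖ ≤ ‖X n i ω‖) (m : ℕ) (κ κ' : ℝ≥0∞) {τ : ℝ}
    (h : b ≤ ‖X n (serving X n ω) ω‖ ^ 2) :
    ∑' p : N × ℕ, annulusExponent θ α m n a b κ τ p.1 (X p.1 p.2 ω) =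
      ∑' p : N × ℕ, annulusExponent θ α m n a b κ' τ p.1 (X p.1 p.2 ω) := by
  refine tsum_congr fun p => ?_
  unfold annulusExponent
  split_ifs with h1 h2 h3 <;> try rfl
  have h4 : ‖X n (serving X n ω) ω‖ ^ 2 ≤ ‖X p.1 p.2 ω‖ ^ 2 := by
    rw [h1]
    exact pow_le_pow_left₀ (norm_nonneg _) (hω p.2) 2
  linarith

/-- If `R² < a`, every term is zero; if `R² ≥ b`, no own transmitter lies in the annulus and `κ` is
immaterial. In between, the `κ = ∞` term vanishes, and discarding annulus points and freezing the
rest at `a` only lowers the exponent. -/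
theorem indicator_conditionalCoverage_add_le (hω : ∀ i, ‖X n (serving X n ω) ω‖ ≤ ‖X n i ω‖)
    (hθ : 0 < θ) (hα : 0 < α) {W η : ℝ} (hn : 0 ≤ η * W) (m : ℕ) (ha : 0 < a) :
    {ω | a ≤ ‖X n (serving X n ω) ω‖ ^ 2 ∧ ‖X n (serving X n ω) ω‖ ^ 2 < b}.indicator
        (conditionalCoverage α W η θ X n m) ω +
      expNeg (noiseExponent α W η θ m a) * expNeg (∑' p : N × ℕ,
        annulusExponent θ α m n a b ∞ a p.1 (X p.1 p.2 ω)) ≤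
      expNeg (noiseExponent α W η θ m a) * expNeg (∑' p : N × ℕ,
        annulusExponent θ α m n a b 0 a p.1 (X p.1 p.2 ω)) := by
  rcases lt_or_ge (‖X n (serving X n ω) ω‖ ^ 2) a with h1 | h1
  · rw [Set.indicator_of_notMem fun h => (not_le.2 h1) h.1,
      tsum_annulusExponent_eq_top m (Or.inl h1), expNeg_top]
    simp
  rcases lt_or_ge (‖X n (serving X n ω) ω‖ ^ 2) b with h2 | h2
  · rw [Set.indicator_of_mem (by exact ⟨h1, h2⟩), tsum_annulusExponent_eq_top m
      (Or.inr ⟨rfl, h2⟩), expNeg_top, mul_zero, add_zero, conditionalCoverage_eq, ← expNeg_add]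
    refine antitone_expNeg (add_le_add (noiseExponent_mono hθ hα hn m ha.le h1)
      (ENNReal.tsum_le_tsum fun p => ?_))
    have hatt := attenuation_mono hθ hα m ha.le h1 (X p.1 p.2 ω)
    have hp : p.1 = n → ¬ ‖X p.1 p.2 ω‖ ^ 2 < a := fun h => by
      rw [h, not_lt]
      exact h1.trans (pow_le_pow_left₀ (norm_nonneg _) (hω p.2) 2)
    by_cases hp1 : p.1 = n
    · rw [annulusExponent, if_pos hp1, if_neg (hp hp1)]
      by_cases hp2 : ‖X p.1 p.2 ω‖ ^ 2 < b
      · rw [if_pos hp2]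
        exact zero_le
      · have hne : p ≠ (n, serving X n ω) := by
          rintro rfl
          exact hp2 h2
        rwa [if_neg hp2, if_neg hne]
    · have hne : p ≠ (n, serving X n ω) := by
        rintro rfl
        exact hp1 rfl
      rwa [annulusExponent, if_neg hp1, if_neg hne]
  · rw [Set.indicator_of_notMem fun h => (not_lt.2 h2) h.2,
      tsum_annulusExponent_congr hω m ∞ 0 h2, zero_add]

/-- The same three cases. For `a ≤ R² < b` the serving transmitter itself contributes `κ = m log(1 +
θ)` to the sum, whence the prefactor; the other own points of the annulus attenuate by at most `κ`.
-/
theorem le_indicator_conditionalCoverage_add (hω : ∀ i, ‖X n (serving X n ω) ω‖ ≤ ‖X n i ω‖)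
    (hθ : 0 < θ) (hα : 0 < α) {W η : ℝ} (hn : 0 ≤ η * W) (m : ℕ) (ha : 0 < a) :
    expNeg (noiseExponent α W η θ m b) * expNeg (∑' p : N × ℕ,
        annulusExponent θ α m n a b (ENNReal.ofReal (m * Real.log (1 + θ))) b p.1 (X p.1 p.2 ω)) ≤
      expNeg (ENNReal.ofReal (m * Real.log (1 + θ))) *
        {ω | a ≤ ‖X n (serving X n ω) ω‖ ^ 2 ∧ ‖X n (serving X n ω) ω‖ ^ 2 < b}.indicator
        (conditionalCoverage α W η θ X n m) ω +
      expNeg (noiseExponent α W η θ m b) * expNeg (∑' p : N × ℕ,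
        annulusExponent θ α m n a b ∞ b p.1 (X p.1 p.2 ω)) := by
  rcases lt_or_ge (‖X n (serving X n ω) ω‖ ^ 2) a with h1 | h1
  · rw [tsum_annulusExponent_eq_top m (Or.inl h1), expNeg_top, mul_zero]
    exact zero_le
  rcases lt_or_ge (‖X n (serving X n ω) ω‖ ^ 2) b with h2 | h2
  · refine le_trans ?_ le_self_add
    rw [Set.indicator_of_mem (by exact ⟨h1, h2⟩), conditionalCoverage_eq, ← expNeg_add,
      ← expNeg_add, add_left_comm,
      ENNReal.tsum_eq_add_tsum_ite (f := fun p : N × ℕ => annulusExponent θ α m n a b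
        (ENNReal.ofReal (m * Real.log (1 + θ))) b p.1 (X p.1 p.2 ω)) (n, serving X n ω)]
    have hR : 0 < ‖X n (serving X n ω) ω‖ ^ 2 := ha.trans_le h1
    refine antitone_expNeg (add_le_add (noiseExponent_mono hθ hα hn m hR.le h2.le)
      (add_le_add ?_ (ENNReal.tsum_le_tsum fun p => ?_)))
    · simp [annulusExponent, not_lt.2 h1, h2]
    · by_cases hne : p = (n, serving X n ω)
      · simp [hne]
      rw [if_neg hne, if_neg hne]
      have hatt := attenuation_mono hθ hα m hR.le h2.le (X p.1 p.2 ω)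
      by_cases hp1 : p.1 = n
      · have hp : ‖X n (serving X n ω) ω‖ ^ 2 ≤ ‖X p.1 p.2 ω‖ ^ 2 := by
          rw [hp1]
          exact pow_le_pow_left₀ (norm_nonneg _) (hω p.2) 2
        rw [annulusExponent, if_pos hp1, if_neg (not_lt.2 (h1.trans hp))]
        split_ifs
        · exact attenuation_le hθ hα m hR hp
        · exact hatt
      · rwa [annulusExponent, if_neg hp1]
  · rw [tsum_annulusExponent_congr hω m ∞ _ h2]
    exact le_add_self

end Pointwise

section Integrated

variable [MeasurableSpace Ω] {P : Measure Ω} [IsProbabilityMeasure P]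
  {lam : N → ℝ} {X : N → ℕ → Ω → Plane} {h : N → ℕ → N → Ω → ℝ} {a b : ℝ}

theorem volume_annulus (ha : 0 ≤ a) (hab : a ≤ b) :
    volume {y : Plane | a ≤ ‖y‖ ^ 2 ∧ ‖y‖ ^ 2 < b} = ENNReal.ofReal (Real.pi * (b - a)) := by
  have hd : {y : Plane | a ≤ ‖y‖ ^ 2 ∧ ‖y‖ ^ 2 < b} =
      {y : Plane | ‖y‖ ^ 2 < b} \ {y : Plane | ‖y‖ ^ 2 < a} := by
    ext y
    simp [and_comm]
  have hs : {y : Plane | ‖y‖ ^ 2 < a} ⊆ {y : Plane | ‖y‖ ^ 2 < b} := fun y hy =>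
    lt_of_lt_of_le (show ‖y‖ ^ 2 < a from hy) hab
  rw [hd, measure_sdiff hs
    (measurableSet_lt (measurable_norm.pow_const 2) measurable_const).nullMeasurableSet
    (by rw [volume_norm_sq_lt ha]; exact ENNReal.ofReal_ne_top), volume_norm_sq_lt ha,
    volume_norm_sq_lt (ha.trans hab), ← ENNReal.ofReal_sub _ (by positivity), mul_sub]

/-- Disc, annulus and exterior contribute separately; the disc has exponent `∞` and counts with its
full area. -/
theorem lintegral_one_sub_expNeg_annulusExponent_self (m : ℕ) (n : N) (ha : 0 ≤ a) (hab : a ≤ b)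
    (κ : ℝ≥0∞) (τ : ℝ) :
    ∫⁻ y, 1 - expNeg (annulusExponent θ α m n a b κ τ n y) =
      ENNReal.ofReal (Real.pi * a) + (1 - expNeg κ) * ENNReal.ofReal (Real.pi * (b - a)) +
        ∫⁻ y in {y : Plane | b ≤ ‖y‖ ^ 2}, 1 - expNeg (attenuation θ α m τ y) := by
  have hlt (c : ℝ) : MeasurableSet {y : Plane | ‖y‖ ^ 2 < c} :=
    measurableSet_lt (measurable_norm.pow_const 2) measurable_const
  have hle (c : ℝ) : MeasurableSet {y : Plane | c ≤ ‖y‖ ^ 2} :=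
    measurableSet_le measurable_const (measurable_norm.pow_const 2)
  have e (y : Plane) : 1 - expNeg (annulusExponent θ α m n a b κ τ n y) =
      {y : Plane | ‖y‖ ^ 2 < a}.indicator 1 y +
        {y : Plane | a ≤ ‖y‖ ^ 2 ∧ ‖y‖ ^ 2 < b}.indicator (fun _ => 1 - expNeg κ) y +
        {y : Plane | b ≤ ‖y‖ ^ 2}.indicator (fun y => 1 - expNeg (attenuation θ α m τ y)) y := by
    simp only [annulusExponent, if_true, Set.indicator_apply, Set.mem_ofPred_eq]
    rcases lt_or_ge (‖y‖ ^ 2) a with h1 | h1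
    · simp [h1, not_le.2 h1, not_le.2 (h1.trans_le hab), expNeg_top]
    · rcases lt_or_ge (‖y‖ ^ 2) b with h2 | h2
      · simp [h1, not_lt.2 h1, h2, not_le.2 h2]
      · simp [h1, not_lt.2 h1, h2, not_lt.2 h2]
  simp only [e]
  have hA : MeasurableSet {y : Plane | a ≤ ‖y‖ ^ 2 ∧ ‖y‖ ^ 2 < b} := (hle a).inter (hlt b)
  have hC : Measurable fun y => 1 - expNeg (attenuation θ α m τ y) :=
    measurable_const.sub (measurable_expNeg.comp (measurable_attenuation θ α m τ))
  rw [lintegral_add_right _ (hC.indicator (hle b)),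
    lintegral_add_right _ (measurable_const.indicator hA), lintegral_indicator_one (hlt a),
    lintegral_indicator_const hA, lintegral_indicator (hle b), volume_norm_sq_lt ha,
    volume_annulus ha hab]

theorem IsModel.lintegral_expNeg_tsum_annulusExponent [Fintype N] (hM : IsModel P lam X h) (hθ : 0 < θ)
    (hα : 2 < α) (m : ℕ) (n : N) (ha : 0 ≤ a) (hab : a ≤ b) (κ : ℝ≥0∞) {τ : ℝ} (hτ : 0 < τ) :
    ∫⁻ ω, expNeg (∑' p : N × ℕ, annulusExponent θ α m n a b κ τ p.1 (X p.1 p.2 ω)) ∂P =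
      expNeg (ENNReal.ofReal (lam n) * (ENNReal.ofReal (Real.pi * a) +
          (1 - expNeg κ) * ENNReal.ofReal (Real.pi * (b - a)) +
          ∫⁻ y in {y : Plane | b ≤ ‖y‖ ^ 2}, 1 - expNeg (attenuation θ α m τ y)) +
        ∑ j ∈ Finset.univ.erase n, ENNReal.ofReal (lam j) *
          ENNReal.ofReal (Real.pi * τ * zetaZeroSum θ α m)) := by
  rw [hM.lintegral_expNeg_tsum fun j => measurable_annulusExponent θ α m n a b κ τ j,
    ← Finset.add_sum_erase _ _ (Finset.mem_univ n),
    lintegral_one_sub_expNeg_annulusExponent_self m n ha hab]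
  congr 2
  refine Finset.sum_congr rfl fun j hj => ?_
  simp only [annulusExponent, if_neg (Finset.ne_of_mem_erase hj)]
  rw [lintegral_one_sub_expNeg_attenuation hθ hα m hτ]

end Integrated

end Increments

/-! ### Densities from bounds on small intervals -/

section Density

theorem hasDerivWithinAt_of_sandwich {V L U : ℝ → ℝ} {f' a : ℝ}
    (hL : HasDerivAt L f' a) (hU : HasDerivAt U f' a) (hLa : L a = 0) (hUa : U a = 0)
    (h : ∀ b, a < b → L b ≤ V b - V a ∧ V b - V a ≤ U b) :
    HasDerivWithinAt V f' (Set.Ioi a) a := by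
  have hl := (hasDerivWithinAt_iff_tendsto_slope' (by simp)).1 (hL.hasDerivWithinAt (s := Set.Ioi a))
  have hu := (hasDerivWithinAt_iff_tendsto_slope' (by simp)).1 (hU.hasDerivWithinAt (s := Set.Ioi a))
  refine (hasDerivWithinAt_iff_tendsto_slope' (by simp)).2
    (tendsto_of_tendsto_of_tendsto_of_le_of_le' hl hu ?_ ?_)
  · filter_upwards [self_mem_nhdsWithin] with b hb
    have hb' : 0 < b - a := sub_pos.2 hb
    rw [slope_def_field, slope_def_field, hLa, sub_zero]
    exact div_le_div_of_nonneg_right (h b hb).1 hb'.le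
  · filter_upwards [self_mem_nhdsWithin] with b hb
    have hb' : 0 < b - a := sub_pos.2 hb
    rw [slope_def_field, slope_def_field, hUa, sub_zero]
    exact div_le_div_of_nonneg_right (h b hb).2 hb'.le

/-- The sandwich on `[a, b)` as `b ↓ a` gives only a right derivative of `t ↦ ν (-∞, t)`; with
continuity this suffices for the fundamental theorem of calculus. -/
theorem measureReal_Ioi_eq_integral {ν : Measure ℝ} [IsFiniteMeasure ν] {f : ℝ → ℝ}
    (hf : IntegrableOn f (Set.Ioi 0)) {L U : ℝ → ℝ → ℝ} {A : ℝ}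
    (hL : ∀ a, 0 < a → HasDerivAt (L a) (f a) a) (hU : ∀ a, 0 < a → HasDerivAt (U a) (f a) a)
    (hLa : ∀ a, L a a = 0) (hUa : ∀ a, U a a = 0)
    (h : ∀ a b, 0 < a → a < b → L a b ≤ ν.real (Set.Ico a b) ∧ ν.real (Set.Ico a b) ≤ U a b)
    (hA : ∀ a b, 0 < a → a < b → ν.real (Set.Ico a b) ≤ Real.exp (A * (b - a)) - 1) :
    ν.real (Set.Ioi 0) = ∫ r in Set.Ioi 0, f r := by
  set V : ℝ → ℝ := fun t => ν.real (Set.Iio t) with hV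
  have hVd {a b : ℝ} (hab : a ≤ b) : V b - V a = ν.real (Set.Ico a b) := by
    have : Set.Ico a b = Set.Iio b \ Set.Iio a := by
      ext
      simp
    rw [this, measureReal_sdiff (Set.Iio_subset_Iio hab) measurableSet_Iio]
  -- Left continuity needs `hA`, which is uniform in the left endpoint; the bounds `L a` and `U a`
  -- have `a` fixed.
  have hcont : ∀ x, 0 < x → ContinuousAt V x := by
    intro x hx
    have hb : ∀ᶠ y in 𝓝 x, |V y - V x| ≤ Real.exp (A * |y - x|) - 1 := by
      filter_upwards [lt_mem_nhds hx] with y hy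
      rcases lt_trichotomy y x with hyx | rfl | hyx
      · rw [abs_sub_comm, abs_sub_comm y, hVd hyx.le, abs_of_nonneg measureReal_nonneg,
          abs_of_pos (sub_pos.2 hyx)]
        exact hA y x hy hyx
      · simp
      · rw [hVd hyx.le, abs_of_nonneg measureReal_nonneg, abs_of_pos (sub_pos.2 hyx)]
        exact hA x y hx hyx
    refine tendsto_iff_norm_sub_tendsto_zero.2
      (squeeze_zero' (Eventually.of_forall fun _ => norm_nonneg _) hb ?_)
    have hc : Continuous fun y : ℝ => Real.exp (A * |y - x|) - 1 := by fun_prop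
    simpa using hc.tendsto x
  have hint {a b : ℝ} (ha : 0 < a) (hab : a ≤ b) :
      ∫ r in Set.Ioc a b, f r = ν.real (Set.Ico a b) := by
    rw [← intervalIntegral.integral_of_le hab, ← hVd hab]
    refine intervalIntegral.integral_eq_sub_of_hasDeriv_right (fun x hx => ?_) (fun x hx => ?_) ?_
    · rw [Set.uIcc_of_le hab] at hx
      exact (hcont x (ha.trans_le hx.1)).continuousWithinAt
    · rw [min_eq_left hab] at hx
      have hx0 : 0 < x := ha.trans hx.1
      exact hasDerivWithinAt_of_sandwich (hL x hx0) (hU x hx0) (hLa x) (hUa x) fun b hb => by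
        rw [hVd hb.le]
        exact h x b hx0 hb
    · rw [intervalIntegrable_iff_integrableOn_Ioc_of_le hab]
      exact hf.mono_set fun x hx => ha.trans hx.1
  -- The integral is known on compact intervals in `(0, ∞)`; exhaust by those from `1/(k+1)` to `k`.
  set ε : ℕ → ℝ := fun k => 1 / ((k : ℝ) + 1) with hε
  have hε0 (k) : 0 < ε k := Nat.one_div_pos_of_nat
  have hεanti : Antitone ε := fun k k' hk => Nat.one_div_le_one_div hk
  have hex {x : ℝ} (hx : 0 < x) : ∃ k : ℕ, ε k < x ∧ x < k := by
    obtain ⟨k, hk⟩ := exists_nat_one_div_lt hx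
    obtain ⟨k', hk'⟩ := exists_nat_gt x
    refine ⟨max k k', (hεanti (le_max_left k k')).trans_lt hk, hk'.trans_le ?_⟩
    exact_mod_cast le_max_right k k'
  have hU1 : ⋃ k, Set.Ioc (ε k) (k : ℝ) = Set.Ioi 0 := by
    ext x
    simp only [Set.mem_iUnion, Set.mem_Ioc, Set.mem_Ioi]
    refine ⟨fun ⟨k, hk⟩ => (hε0 k).trans hk.1, fun hx => ?_⟩
    obtain ⟨k, hk⟩ := hex hx
    exact ⟨k, hk.1, hk.2.le⟩
  have hU2 : ⋃ k, Set.Ico (ε k) (k : ℝ) = Set.Ioi 0 := by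
    ext x
    simp only [Set.mem_iUnion, Set.mem_Ico, Set.mem_Ioi]
    refine ⟨fun ⟨k, hk⟩ => (hε0 k).trans_le hk.1, fun hx => ?_⟩
    obtain ⟨k, hk⟩ := hex hx
    exact ⟨k, hk.1.le, hk.2⟩
  have hm1 : Monotone fun k : ℕ => Set.Ioc (ε k) (k : ℝ) := fun k k' hk =>
    Set.Ioc_subset_Ioc (hεanti hk) (by exact_mod_cast hk)
  have hm2 : Monotone fun k : ℕ => Set.Ico (ε k) (k : ℝ) := fun k k' hk =>
    Set.Ico_subset_Ico (hεanti hk) (by exact_mod_cast hk)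
  have t1 := tendsto_setIntegral_of_monotone (fun k => measurableSet_Ioc) hm1 (hU1.symm ▸ hf)
  have t2 := (ENNReal.tendsto_toReal (measure_ne_top ν _)).comp (tendsto_measure_iUnion_atTop
    (μ := ν) hm2)
  rw [hU1] at t1
  rw [hU2] at t2
  refine tendsto_nhds_unique t2 (t1.congr' ?_)
  filter_upwards [eventually_ge_atTop 1] with k hk
  have hk' : (1 : ℝ) ≤ k := by exact_mod_cast hk
  refine hint (hε0 k) (le_trans ?_ hk')
  rw [hε, div_le_one (by positivity)]
  linarith

/-- At a zero of `M` the derivative of `g` drops out, so the slowly varying factors of the bounds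
need only be differentiable. -/
theorem hasDerivAt_mul_of_eq_zero {g M : ℝ → ℝ} {M' a : ℝ} (hg : DifferentiableAt ℝ g a)
    (hM : HasDerivAt M M' a) (h0 : M a = 0) : HasDerivAt (fun b => g b * M b) (g a * M') a := by
  have h := hg.hasDerivAt.mul hM
  rw [h0, mul_zero, zero_add] at h
  exact h

end Density

/-! ### The weighted law of the distance of the serving transmitter -/

section CoverageMass

variable {Ω N : Type*} [MeasurableSpace Ω] {P : Measure Ω} {lam : N → ℝ} {X : N → ℕ → Ω → Plane} {h : N → ℕ → N → Ω → ℝ}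
  {θ α a b : ℝ}

/-- The law of the squared distance of the serving transmitter, weighted by the conditional
coverage probability. -/
def coverageMass [DecidableEq N] (P : Measure Ω) (α W η θ : ℝ) (X : N → ℕ → Ω → Plane) (n : N) (m : ℕ) :
    Measure ℝ :=
  (P.withDensity (conditionalCoverage α W η θ X n m)).map fun ω => ‖X n (serving X n ω) ω‖ ^ 2

/-- The contribution of the noise to the `m`-th integrand. -/
def noiseFactor (α W η θ : ℝ) (m : ℕ) (t : ℝ) : ℝ := Real.exp (-(θ * t ^ (α / 2) * m * (η * W)))

/-- The total intensity of the other operators in the `m`-th integrand. -/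
def otherIntensity [Fintype N] [DecidableEq N] (lam : N → ℝ) (θ α : ℝ) (n : N) (m : ℕ) : ℝ :=
  Real.pi * ∑ j ∈ Finset.univ.erase n, lam j * zetaZeroSum θ α m

theorem expNeg_noiseExponent (hθ : 0 < θ) {W η : ℝ} (hn : 0 ≤ η * W) (m : ℕ) {t : ℝ}
    (ht : 0 ≤ t) :
    expNeg (noiseExponent α W η θ m t) = ENNReal.ofReal (noiseFactor α W η θ m t) := by
  rw [noiseExponent, expNeg_ofReal (by positivity), noiseFactor]
  congr 3
  ring

theorem otherIntensity_nonneg [Fintype N] [DecidableEq N] (hlam : ∀ j, 0 < lam j) (hθ : 0 < θ) (hα : 2 < α) (n : N) (m : ℕ) :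
    0 ≤ otherIntensity lam θ α n m :=
  mul_nonneg Real.pi_pos.le (Finset.sum_nonneg fun j _ =>
    mul_nonneg (hlam j).le (zetaZeroSum_nonneg hθ hα m))

theorem IsModel.lintegral_expNeg_tsum_annulusExponent_eq_ofReal [Fintype N] [DecidableEq N]
    [IsProbabilityMeasure P] (hM : IsModel P lam X h)
    (hlam : ∀ j, 0 < lam j) (hθ : 0 < θ) (hα : 2 < α) (m : ℕ) (n : N) (ha : 0 ≤ a) (hab : a ≤ b)
    {κ : ℝ≥0∞} {c K τ : ℝ} (hc : 0 ≤ c) (hκ : 1 - expNeg κ = ENNReal.ofReal c) (hK : 0 ≤ K)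
    (hτ : 0 < τ) (hI : ∫⁻ y in {y : Plane | b ≤ ‖y‖ ^ 2}, 1 - expNeg (attenuation θ α m τ y) =
      ENNReal.ofReal K) :
    ∫⁻ ω, expNeg (∑' p : N × ℕ, annulusExponent θ α m n a b κ τ p.1 (X p.1 p.2 ω)) ∂P =
      ENNReal.ofReal (Real.exp (-(lam n * (Real.pi * a + c * (Real.pi * (b - a)) + K) +
        τ * otherIntensity lam θ α n m))) := by
  have hba : 0 ≤ b - a := sub_nonneg.2 hab
  have hl := (hlam n).le
  have hZ := zetaZeroSum_nonneg hθ hα m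
  have hO := otherIntensity_nonneg (θ := θ) (α := α) hlam hθ hα n m
  have hs : ∑ j ∈ Finset.univ.erase n, ENNReal.ofReal (lam j) *
      ENNReal.ofReal (Real.pi * τ * zetaZeroSum θ α m) =
      ENNReal.ofReal (τ * otherIntensity lam θ α n m) := by
    have (j : N) : ENNReal.ofReal (lam j) * ENNReal.ofReal (Real.pi * τ * zetaZeroSum θ α m) =
        ENNReal.ofReal (lam j * (Real.pi * τ * zetaZeroSum θ α m)) :=
      (ENNReal.ofReal_mul (hlam j).le).symm
    simp only [this]
    rw [← ENNReal.ofReal_sum_of_nonneg fun j _ => mul_nonneg (hlam j).le (by positivity),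
      otherIntensity, Finset.mul_sum, Finset.mul_sum]
    congr 1
    exact Finset.sum_congr rfl fun j _ => by ring
  rw [hM.lintegral_expNeg_tsum_annulusExponent hθ hα m n ha hab κ hτ, hs, hκ, hI,
    ← ENNReal.ofReal_mul hc, ← ENNReal.ofReal_add (by positivity) (by positivity),
    ← ENNReal.ofReal_add (by positivity) hK, ← ENNReal.ofReal_mul hl,
    ← ENNReal.ofReal_add (by positivity) (by positivity), expNeg_ofReal (by positivity)]

theorem IsModel.measurable_serving_norm_sq (hM : IsModel P lam X h) (n : N) :
    Measurable fun ω => ‖X n (serving X n ω) ω‖ ^ 2 :=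
  (measurable_serving_apply hM.measurable_location n
    fun i => (hM.measurable_location n i).norm).pow_const 2

theorem IsModel.coverageMass_apply [DecidableEq N] (hM : IsModel P lam X h) (α W η θ : ℝ) (n : N) (m : ℕ)
    {s : Set ℝ} (hs : MeasurableSet s) :
    coverageMass P α W η θ X n m s =
      ∫⁻ ω, ((fun ω => ‖X n (serving X n ω) ω‖ ^ 2) ⁻¹' s).indicator
        (conditionalCoverage α W η θ X n m) ω ∂P := by
  have hR := hM.measurable_serving_norm_sq n
  rw [coverageMass, Measure.map_apply hR hs, withDensity_apply _ (hR hs),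
    lintegral_indicator (hR hs)]

theorem isFiniteMeasure_coverageMass [DecidableEq N] (P : Measure Ω) [IsProbabilityMeasure P] (α W η θ : ℝ)
    (X : N → ℕ → Ω → Plane) (n : N) (m : ℕ) : IsFiniteMeasure (coverageMass P α W η θ X n m) := by
  have : IsFiniteMeasure (P.withDensity (conditionalCoverage α W η θ X n m)) := by
    refine isFiniteMeasure_withDensity (ne_top_of_le_ne_top ENNReal.one_ne_top ?_)
    refine (lintegral_mono fun ω => expNeg_le_one _).trans ?_
    simp
  unfold coverageMass
  infer_instance

theorem one_sub_expNeg_zero : 1 - expNeg 0 = ENNReal.ofReal 0 := by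
  simp [expNeg_zero]

theorem one_sub_expNeg_top : 1 - expNeg ∞ = ENNReal.ofReal 1 := by
  simp [expNeg_top]

theorem IsModel.measurable_expNeg_tsum_annulusExponent [Countable N] [DecidableEq N] (hM : IsModel P lam X h) (θ α : ℝ) (m : ℕ)
    (n : N) (a b : ℝ) (κ : ℝ≥0∞) (τ : ℝ) :
    Measurable fun ω => expNeg (∑' p : N × ℕ,
      annulusExponent θ α m n a b κ τ p.1 (X p.1 p.2 ω)) :=
  measurable_expNeg.comp (Measurable.tsum fun p =>
    (measurable_annulusExponent θ α m n a b κ τ p.1).comp (hM.measurable_location _ _))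

theorem IsModel.coverageMass_Ico_le [Fintype N] [DecidableEq N]
    [IsProbabilityMeasure P] (hM : IsModel P lam X h) (hlam : ∀ j, 0 < lam j) (hθ : 0 < θ)
    (hα : 2 < α) {W η : ℝ} (hn : 0 ≤ η * W) (m : ℕ) (n : N) (ha : 0 < a) (hab : a ≤ b) :
    (coverageMass P α W η θ X n m).real (Set.Ico a b) ≤
      noiseFactor α W η θ m a * Real.exp (-(a * (Real.pi * lam n * zetaSum θ α m +
          otherIntensity lam θ α n m))) *
        (Real.exp (Real.pi * lam n * (b - a)) *
          (Real.exp (-(Real.pi * lam n * a)) - Real.exp (-(Real.pi * lam n * b)))) := by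
  have hα0 : 0 < α := by linarith
  have hI : ∫⁻ y in {y : Plane | b ≤ ‖y‖ ^ 2}, 1 - expNeg (attenuation θ α m a y) ≠ ∞ := by
    refine ne_top_of_le_ne_top ?_ (setLIntegral_le_lintegral _ _)
    rw [lintegral_one_sub_expNeg_attenuation hθ hα m ha]
    exact ENNReal.ofReal_ne_top
  set I := ∫⁻ y in {y : Plane | b ≤ ‖y‖ ^ 2}, 1 - expNeg (attenuation θ α m a y) with hIdef
  obtain ⟨K, hK0, hIK⟩ : ∃ K : ℝ, 0 ≤ K ∧ I = ENNReal.ofReal K :=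
    ⟨I.toReal, ENNReal.toReal_nonneg, (ENNReal.ofReal_toReal hI).symm⟩
  have hZ := zetaSum_nonneg hθ hα m
  -- `K` belongs to attenuation at `√a` outside radius `√b`. Enlarging the region to radius `√a`
  -- adds at most the annulus area, as the integrand is at most `1`; this costs the factor `exp(π
  -- λ_n (b - a))`.
  have hK : Real.pi * a * zetaSum θ α m ≤ Real.pi * (b - a) + K := by
    have hba : 0 ≤ b - a := sub_nonneg.2 hab
    rw [← ENNReal.ofReal_le_ofReal_iff (by positivity), ENNReal.ofReal_add (by positivity) hK0,
      ← setLIntegral_one_sub_expNeg_attenuation hθ hα m ha, ← hIK, ← volume_annulus ha.le hab]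
    have hsub : {y : Plane | a ≤ ‖y‖ ^ 2} ⊆
        {y : Plane | a ≤ ‖y‖ ^ 2 ∧ ‖y‖ ^ 2 < b} ∪ {y : Plane | b ≤ ‖y‖ ^ 2} := fun y hy =>
      (lt_or_ge (‖y‖ ^ 2) b).imp (fun h => ⟨hy, h⟩) id
    refine (lintegral_mono_set hsub).trans ((lintegral_union_le _ _ _).trans
      (add_le_add_left ?_ _))
    refine (lintegral_mono fun y => tsub_le_self).trans ?_
    rw [setLIntegral_one]
  have h1 : coverageMass P α W η θ X n m (Set.Ico a b) + expNeg (noiseExponent α W η θ m a) *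
      ∫⁻ ω, expNeg (∑' p : N × ℕ, annulusExponent θ α m n a b ∞ a p.1 (X p.1 p.2 ω)) ∂P ≤
      expNeg (noiseExponent α W η θ m a) *
      ∫⁻ ω, expNeg (∑' p : N × ℕ, annulusExponent θ α m n a b 0 a p.1 (X p.1 p.2 ω)) ∂P := by
    rw [hM.coverageMass_apply α W η θ n m measurableSet_Ico,
      ← lintegral_const_mul' _ _ (expNeg_ne_top _), ← lintegral_const_mul' _ _ (expNeg_ne_top _),
      ← lintegral_add_right _
        ((hM.measurable_expNeg_tsum_annulusExponent θ α m n a b ∞ a).const_mul _)]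
    refine lintegral_mono_ae ?_
    filter_upwards [hM.ae_serving_spec n] with ω hω
    exact indicator_conditionalCoverage_add_le hω hθ hα0 hn m ha
  rw [hM.lintegral_expNeg_tsum_annulusExponent_eq_ofReal hlam hθ hα m n ha.le hab zero_le_one
      one_sub_expNeg_top hK0 ha hIK,
    hM.lintegral_expNeg_tsum_annulusExponent_eq_ofReal hlam hθ hα m n ha.le hab le_rfl
      one_sub_expNeg_zero hK0 ha hIK, expNeg_noiseExponent hθ hn m ha.le] at h1
  have hC : 0 ≤ noiseFactor α W η θ m a := (Real.exp_pos _).le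
  have hfin := isFiniteMeasure_coverageMass P α W η θ X n m
  rw [← ofReal_measureReal, ← ENNReal.ofReal_mul hC, ← ENNReal.ofReal_mul hC,
    ← ENNReal.ofReal_add measureReal_nonneg (by positivity),
    ENNReal.ofReal_le_ofReal_iff (by positivity)] at h1
  set O := otherIntensity lam θ α n m
  set Z := zetaSum θ α m
  have e1 : Real.exp (-(lam n * (Real.pi * a + 0 * (Real.pi * (b - a)) + K) + a * O)) =
      Real.exp (-(lam n * K + a * O)) * Real.exp (-(Real.pi * lam n * a)) := by
    rw [← Real.exp_add]
    congr 1
    ring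
  have e2 : Real.exp (-(lam n * (Real.pi * a + 1 * (Real.pi * (b - a)) + K) + a * O)) =
      Real.exp (-(lam n * K + a * O)) * Real.exp (-(Real.pi * lam n * b)) := by
    rw [← Real.exp_add]
    congr 1
    ring
  have h2 : Real.exp (-(lam n * K + a * O)) ≤
      Real.exp (-(a * (Real.pi * lam n * Z + O))) * Real.exp (Real.pi * lam n * (b - a)) := by
    rw [← Real.exp_add, Real.exp_le_exp]
    nlinarith [hlam n]
  have h3 : 0 ≤ Real.exp (-(Real.pi * lam n * a)) - Real.exp (-(Real.pi * lam n * b)) := by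
    rw [sub_nonneg, Real.exp_le_exp, neg_le_neg_iff]
    have := hlam n
    gcongr
  rw [e1, e2] at h1
  have h4 := mul_le_mul_of_nonneg_left (mul_le_mul_of_nonneg_right h2 h3) hC
  linarith

theorem IsModel.le_coverageMass_Ico [Fintype N] [DecidableEq N]
    [IsProbabilityMeasure P] (hM : IsModel P lam X h) (hlam : ∀ j, 0 < lam j) (hθ : 0 < θ)
    (hα : 2 < α) {W η : ℝ} (hn : 0 ≤ η * W) (m : ℕ) (n : N) (ha : 0 < a) (hab : a ≤ b) :
    noiseFactor α W η θ m b * Real.exp (-(b * (Real.pi * lam n * zetaSum θ α m +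
        otherIntensity lam θ α n m))) *
      ((1 + θ) ^ m * (Real.exp (-(Real.pi * lam n *
          (a + (1 - ((1 + θ) ^ m)⁻¹) * (b - a)))) - Real.exp (-(Real.pi * lam n * b)))) ≤
      (coverageMass P α W η θ X n m).real (Set.Ico a b) := by
  have hα0 : 0 < α := by linarith
  have hb : 0 < b := ha.trans_le hab
  have hZ := zetaSum_nonneg hθ hα m
  have hI := setLIntegral_one_sub_expNeg_attenuation hθ hα m hb
  have hq0 : 0 ≤ 1 - ((1 + θ) ^ m)⁻¹ := one_sub_inv_pow_nonneg m hθ.le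
  have hκ : 1 - expNeg (ENNReal.ofReal (m * Real.log (1 + θ))) =
      ENNReal.ofReal (1 - ((1 + θ) ^ m)⁻¹) := by
    rw [expNeg_mul_log m hθ.le, ← ENNReal.ofReal_one, ← ENNReal.ofReal_sub _ (by positivity)]
  have h1 : expNeg (noiseExponent α W η θ m b) * (∫⁻ ω, expNeg (∑' p : N × ℕ,
        annulusExponent θ α m n a b (ENNReal.ofReal (m * Real.log (1 + θ))) b p.1
          (X p.1 p.2 ω)) ∂P) ≤
      expNeg (ENNReal.ofReal (m * Real.log (1 + θ))) *
        coverageMass P α W η θ X n m (Set.Ico a b) + expNeg (noiseExponent α W η θ m b) *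
      ∫⁻ ω, expNeg (∑' p : N × ℕ, annulusExponent θ α m n a b ∞ b p.1 (X p.1 p.2 ω)) ∂P := by
    rw [hM.coverageMass_apply α W η θ n m measurableSet_Ico,
      ← lintegral_const_mul' _ _ (expNeg_ne_top _), ← lintegral_const_mul' _ _ (expNeg_ne_top _),
      ← lintegral_const_mul' _ _ (expNeg_ne_top _), ← lintegral_add_right _
        ((hM.measurable_expNeg_tsum_annulusExponent θ α m n a b ∞ b).const_mul _)]
    refine lintegral_mono_ae ?_
    filter_upwards [hM.ae_serving_spec n] with ω hω
    exact le_indicator_conditionalCoverage_add hω hθ hα0 hn m ha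
  rw [hM.lintegral_expNeg_tsum_annulusExponent_eq_ofReal hlam hθ hα m n ha.le hab zero_le_one
      one_sub_expNeg_top (by positivity) hb hI,
    hM.lintegral_expNeg_tsum_annulusExponent_eq_ofReal hlam hθ hα m n ha.le hab hq0
      hκ (by positivity) hb hI, expNeg_noiseExponent hθ hn m hb.le, expNeg_mul_log m hθ.le] at h1
  have hC : 0 ≤ noiseFactor α W η θ m b := (Real.exp_pos _).le
  have hfin := isFiniteMeasure_coverageMass P α W η θ X n m
  rw [← ofReal_measureReal, ← ENNReal.ofReal_mul hC, ← ENNReal.ofReal_mul hC,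
    ← ENNReal.ofReal_mul (by positivity), ← ENNReal.ofReal_add (by positivity) (by positivity),
    ENNReal.ofReal_le_ofReal_iff (by positivity)] at h1
  set O := otherIntensity lam θ α n m
  set Z := zetaSum θ α m
  set q := ((1 + θ) ^ m)⁻¹ with hq
  have e1 : Real.exp (-(lam n * (Real.pi * a + (1 - q) * (Real.pi * (b - a)) +
      Real.pi * b * Z) + b * O)) = Real.exp (-(b * (Real.pi * lam n * Z + O))) *
        Real.exp (-(Real.pi * lam n * (a + (1 - q) * (b - a)))) := by
    rw [← Real.exp_add]
    congr 1
    ring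
  have e2 : Real.exp (-(lam n * (Real.pi * a + 1 * (Real.pi * (b - a)) +
      Real.pi * b * Z) + b * O)) = Real.exp (-(b * (Real.pi * lam n * Z + O))) *
        Real.exp (-(Real.pi * lam n * b)) := by
    rw [← Real.exp_add]
    congr 1
    ring
  rw [e1, e2] at h1
  have hqq : (1 + θ) ^ m * q = 1 := mul_inv_cancel₀ (by positivity)
  have hp : (0 : ℝ) ≤ (1 + θ) ^ m := by positivity
  -- Multiplying by `(1 + θ)^m` removes the factor `expNeg κ` in front of the mass.
  have h2 := mul_le_mul_of_nonneg_left h1 hp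
  linear_combination h2 + (coverageMass P α W η θ X n m).real (Set.Ico a b) * hqq

theorem coverageIntegrand_eq [Fintype N] [DecidableEq N] (lam : N → ℝ) (α W η θ : ℝ) (n : N) (m : ℕ) (r : ℝ) :
    coverageIntegrand lam α W η θ n m r = noiseFactor α W η θ m r *
      Real.exp (-(r * (Real.pi * lam n * zetaSum θ α m + otherIntensity lam θ α n m))) *
        Real.exp (-(Real.pi * lam n * r)) := by
  rw [coverageIntegrand, noiseFactor, otherIntensity, zetaSum]
  simp only [zetaZeroSum]
  rw [mul_assoc (Real.exp _) (Real.exp (-(r * _))), ← Real.exp_add (-(r * _))]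
  congr 2
  ring

theorem integrableOn_coverageIntegrand [Fintype N] [DecidableEq N] (hlam : ∀ j, 0 < lam j) (hθ : 0 < θ) (hα : 2 < α)
    {W η : ℝ} (hn : 0 ≤ η * W) (n : N) (m : ℕ) :
    IntegrableOn (coverageIntegrand lam α W η θ n m) (Set.Ioi 0) := by
  have hA : 0 < Real.pi * lam n := mul_pos Real.pi_pos (hlam n)
  refine Integrable.mono' (exp_neg_integrableOn_Ioi 0 hA) ?_ ?_
  · apply Measurable.aestronglyMeasurable
    unfold coverageIntegrand
    fun_prop
  · filter_upwards [ae_restrict_mem measurableSet_Ioi] with r hr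
    have hr' : (0 : ℝ) < r := hr
    have hZ := zetaSum_nonneg hθ hα m
    have hO := otherIntensity_nonneg (θ := θ) (α := α) hlam hθ hα n m
    have h1 : noiseFactor α W η θ m r ≤ 1 := Real.exp_le_one_iff.2 (neg_nonpos.2 (by positivity))
    have h2 : Real.exp (-(r * (Real.pi * lam n * zetaSum θ α m + otherIntensity lam θ α n m))) ≤ 1 :=
      Real.exp_le_one_iff.2 (neg_nonpos.2 (by positivity))
    have h0 : 0 ≤ noiseFactor α W η θ m r := (Real.exp_pos _).le
    rw [coverageIntegrand_eq, Real.norm_of_nonneg (by positivity), neg_mul]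
    exact mul_le_of_le_one_left (Real.exp_pos _).le (mul_le_one₀ h1 (Real.exp_pos _).le h2)

theorem differentiableAt_noiseFactor (W η θ : ℝ) (m : ℕ) {t : ℝ} (ht : 0 < t) :
    DifferentiableAt ℝ (noiseFactor α W η θ m) t := by
  have h : DifferentiableAt ℝ (fun t : ℝ => t ^ (α / 2)) t :=
    (Real.hasDerivAt_rpow_const (Or.inl ht.ne')).differentiableAt
  unfold noiseFactor
  fun_prop

theorem IsModel.lintegral_conditionalCoverage [Fintype N] [DecidableEq N]
    [IsProbabilityMeasure P] (hM : IsModel P lam X h) (hlam : ∀ j, 0 < lam j)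
    (hθ : 0 < θ) (hα : 2 < α) {W η : ℝ} (hn : 0 ≤ η * W) (m : ℕ) (n : N) :
    (∫⁻ ω, conditionalCoverage α W η θ X n m ω ∂P).toReal =
      Real.pi * lam n * ∫ r in Set.Ioi 0, coverageIntegrand lam α W η θ n m r := by
  have hfin := isFiniteMeasure_coverageMass P α W η θ X n m
  have hmass : ∫⁻ ω, conditionalCoverage α W η θ X n m ω ∂P =
      coverageMass P α W η θ X n m (Set.Ioi 0) := by
    rw [hM.coverageMass_apply α W η θ n m measurableSet_Ioi]
    refine lintegral_congr_ae ?_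
    filter_upwards [hM.ae_ne_zero n] with ω hω
    rw [Set.indicator_of_mem]
    exact pow_pos (norm_pos_iff.2 (hω _)) 2
  rw [hmass, ← measureReal_def, ← integral_const_mul]
  set A := Real.pi * lam n with hAdef
  have hA : 0 < A := mul_pos Real.pi_pos (hlam n)
  set O := otherIntensity lam θ α n m with hOdef
  set Z := zetaSum θ α m with hZdef
  have hZ : 0 ≤ Z := zetaSum_nonneg hθ hα m
  have hO : 0 ≤ O := otherIntensity_nonneg hlam hθ hα n m
  have hlin (c d x : ℝ) : HasDerivAt (fun b : ℝ => Real.exp (-(A * (c + d * (b - c)))))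
      (-(A * d) * Real.exp (-(A * (c + d * (x - c))))) x := by
    have h := ((((((hasDerivAt_id x).sub_const c).const_mul d).const_add c).const_mul A).neg).exp
    convert! h using 1
    simp only [id, Pi.neg_apply]
    ring
  have hlin' (x : ℝ) : HasDerivAt (fun b : ℝ => Real.exp (-(A * b)))
      (-A * Real.exp (-(A * x))) x := by
    have h := ((((hasDerivAt_id x).const_mul A).neg).exp)
    convert! h using 1
    simp only [id, Pi.neg_apply]
    ring
  refine measureReal_Ioi_eq_integral (A := A)
    (L := fun a b => noiseFactor α W η θ m b * Real.exp (-(b * (A * Z + O))) *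
      ((1 + θ) ^ m * (Real.exp (-(A * (a + (1 - ((1 + θ) ^ m)⁻¹) * (b - a)))) -
        Real.exp (-(A * b)))))
    (U := fun a b => noiseFactor α W η θ m a * Real.exp (-(a * (A * Z + O))) *
        (Real.exp (A * (b - a)) * (Real.exp (-(A * a)) - Real.exp (-(A * b)))))
    ((integrableOn_coverageIntegrand hlam hθ hα hn n m).const_mul _)
    (fun a ha => ?_) (fun a ha => ?_) (fun a => ?_) (fun a => ?_) (fun a b ha hab => ⟨?_, ?_⟩)
    (fun a b ha hab => ?_)
  -- At `b = a` the difference of exponentials has slope proportional to `A - A(1 - (1+θ)^(-m)) = A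
  -- (1+θ)^(-m)`, and the prefactor `(1+θ)^m` restores `A`.
  · have hp : (1 + θ) ^ m ≠ 0 := by positivity
    have hg : DifferentiableAt ℝ (fun b => noiseFactor α W η θ m b *
        Real.exp (-(b * (A * Z + O)))) a :=
      (differentiableAt_noiseFactor W η θ m ha).mul (by fun_prop)
    have hM' := ((hlin a (1 - ((1 + θ) ^ m)⁻¹) a).sub (hlin' a)).const_mul ((1 + θ) ^ m)
    refine (hasDerivAt_mul_of_eq_zero hg hM' (by simp)).congr_deriv ?_
    rw [coverageIntegrand_eq, ← hAdef, ← hZdef, ← hOdef]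
    simp only [sub_self, mul_zero, add_zero]
    field_simp
    ring
  · have hM' := (hlin' a).const_sub (Real.exp (-(A * a)))
    have hE : DifferentiableAt ℝ (fun b => Real.exp (A * (b - a))) a := by fun_prop
    refine ((hasDerivAt_mul_of_eq_zero hE hM' (by simp)).const_mul _).congr_deriv ?_
    rw [coverageIntegrand_eq, ← hAdef, ← hZdef, ← hOdef]
    simp only [sub_self, mul_zero, Real.exp_zero]
    ring
  · simp
  · simp
  · exact hM.le_coverageMass_Ico hlam hθ hα hn m n ha hab.le
  · exact hM.coverageMass_Ico_le hlam hθ hα hn m n ha hab.le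
  · refine (hM.coverageMass_Ico_le hlam hθ hα hn m n ha hab.le).trans ?_
    rw [← hAdef, ← hZdef, ← hOdef]
    have h1 : noiseFactor α W η θ m a ≤ 1 := Real.exp_le_one_iff.2 (neg_nonpos.2 (by positivity))
    have h2 : Real.exp (-(a * (A * Z + O))) ≤ 1 :=
      Real.exp_le_one_iff.2 (neg_nonpos.2 (by positivity))
    have h3 : Real.exp (A * (b - a)) * (Real.exp (-(A * a)) - Real.exp (-(A * b))) =
        Real.exp (-(A * a)) * (Real.exp (A * (b - a)) - 1) := by
      have h4 : Real.exp (A * (b - a)) * Real.exp (-(A * b)) = Real.exp (-(A * a)) := by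
        rw [← Real.exp_add]
        congr 1
        ring
      linear_combination -h4
    have h4 : 0 ≤ Real.exp (A * (b - a)) - 1 :=
      sub_nonneg.2 (Real.one_le_exp (mul_nonneg hA.le (sub_nonneg.2 hab.le)))
    have h5 : Real.exp (-(A * a)) ≤ 1 := Real.exp_le_one_iff.2 (neg_nonpos.2 (by positivity))
    rw [h3]
    refine (mul_le_of_le_one_left (mul_nonneg (Real.exp_pos _).le h4)
      (mul_le_one₀ h1 (Real.exp_pos _).le h2)).trans (mul_le_of_le_one_left h4 h5)

end CoverageMass

end

end SpectrumSharing

/-- The coverage probability of a user of operator `n` under frequency-selective fading. -/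
theorem proposition3 {Ω : Type*} [MeasurableSpace Ω] (P : MeasureTheory.Measure Ω)
    [MeasureTheory.IsProbabilityMeasure P] {N : Type*} [Fintype N] [DecidableEq N]
    (lam : N → ℝ) (hlam : ∀ j, 0 < lam j)
    (X : N → ℕ → Ω → SpectrumSharing.Plane) (h : N → ℕ → N → Ω → ℝ)
    (hmodel : SpectrumSharing.IsModel P lam X h)
    (α W η θ : ℝ) (hα : 2 < α) (hW : 0 ≤ W) (hη : 0 ≤ η) (hθ : 0 < θ) (n : N) :
    (∀ k ∈ Finset.Icc 1 (Fintype.card N),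
      MeasureTheory.IntegrableOn
        (SpectrumSharing.coverageIntegrand lam α W η θ n k) (Set.Ioi 0)) ∧
    SpectrumSharing.coverageProbability P α W η θ X h n =
      Real.pi * lam n * ∑ k ∈ Finset.Icc 1 (Fintype.card N),
        ((Fintype.card N).choose k : ℝ) * (-1) ^ (k + 1) *
          ∫ r in Set.Ioi (0 : ℝ), SpectrumSharing.coverageIntegrand lam α W η θ n k r := by
  open SpectrumSharing in
  have hn : 0 ≤ η * W := mul_nonneg hη hW
  refine ⟨fun k _ => integrableOn_coverageIntegrand hlam hθ hα hn n k, ?_⟩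
  set J : ℕ → ℝ := fun k => ∫ r in Set.Ioi (0 : ℝ), coverageIntegrand lam α W η θ n k r
  -- Inclusion–exclusion omits the empty set of bands, hence `F 0 = 0`. The summand then depends on
  -- the cardinality alone, and grouping by it produces the binomial coefficients.
  set F : ℕ → ℝ := fun k => if k = 0 then 0 else (-1) ^ (k + 1) * (Real.pi * lam n * J k) with hF
  let E : N → Set Ω := fun k => {ω | ENNReal.ofReal θ < SINR α W η X h n k ω}
  have hE (k : N) : MeasurableSet (E k) := measurableSet_lt measurable_const
    (measurable_SINR hmodel.measurable_location hmodel.measurable_fading α W η n k)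
  have hcov : coverageProbability P α W η θ X h n = P.real (⋃ k ∈ Finset.univ, E k) := by
    rw [coverageProbability]
    congr 1
    ext ω
    simp [E]
  rw [hcov, measureReal_biUnion_eq_sum_powerset fun k _ => hE k, Finset.sum_filter]
  have hterm : ∀ S ∈ (Finset.univ : Finset N).powerset,
      (if S.Nonempty then (-1 : ℝ) ^ (S.card + 1) * P.real (⋂ k ∈ S, E k) else 0) = F S.card := by
    intro S _
    by_cases hS : S.Nonempty
    · have hset : (⋂ k ∈ S, E k) = {ω | ∀ k ∈ S, ENNReal.ofReal θ < SINR α W η X h n k ω} := by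
        ext ω
        simp [E]
      rw [if_pos hS, hF, hset, measureReal_def, hmodel.measure_forall_lt_SINR hθ n S,
        hmodel.lintegral_conditionalCoverage hlam hθ hα hn S.card n]
      simp only [if_neg hS.card_ne_zero]
      rfl
    · simp [hF, Finset.not_nonempty_iff_eq_empty.1 hS]
  rw [Finset.sum_congr rfl hterm, Finset.sum_powerset_apply_card F, Finset.card_univ,
    Finset.range_eq_Ico, Finset.sum_eq_sum_Ico_succ_bot (Nat.succ_pos _), Finset.mul_sum,
    zero_add, Nat.succ_eq_add_one, Finset.Ico_add_one_right_eq_Icc]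
  simp only [hF, if_true, smul_zero, zero_add]
  refine Finset.sum_congr rfl fun k hk => ?_
  rw [if_neg (by have := (Finset.mem_Icc.1 hk).1; omega), nsmul_eq_mul]
  ring
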